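/- **Proposition (Norm of the lean adjoint state).** Let $d\in\mathbb N$. Let $\alpha,\beta:[0,1]\to\mathbb R$ be continuous on $[0,1]$ and differentiable on $(0,1)$, with $\alpha_0=0$, $\alpha_1=1$, $\beta_1=0$ and $\alpha_t>0$ on $(0,1)$. Put $$\kappa_t=\frac{\dot\alpha_t}{\alpha_t},\qquad \eta_t=\beta_t\Big(\frac{\dot\alpha_t}{\alpha_t}\beta_t-\dot\beta_t\Big),$$ and assume that $\eta_t\ge 0$ on $(0,1)$ and that $\kappa$ is integrable on $[t,1]$ for every $t\in(0,1]$ (as is the case if $\alpha$ is nondecreasing). Let $p^{\mathrm{base}}$ be a positive $C^2$ probability density on $\mathbb R^d$ which is $\frac1{\sigma_1^2}$-strongly log-concave for some $\sigma_1>0$, i.e. $-\nabla^2\log p^{\mathrm{base}}(x)\succeq\frac1{\sigma_1^2}\mathrm I$ for all $x$. Let $p_t$ be the density of $\alpha_tY+\beta_t\varepsilon$, where $Y\sim p^{\mathrm{base}}$ and $\varepsilon\sim\mathcal N(0,\mathrm I)$ are independent, let $\mathfrak s_t=\nabla\log p_t$, and let $$b_\sigma(x,t)=\kappa_t x+\Big(\frac{\sigma(t)^2}{2}+\eta_t\Big)\mathfrak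 s_t(x)$$ with the memoryless noise schedule $\sigma(t)=\sqrt{2\eta_t}$. Let $r:\mathbb R^d\to\mathbb R$ be differentiable and let $X:[0,1]\to\mathbb R^d$ be any trajectory; in particular, $X$ may be any realization of the controlled process $\mathrm dX^u_t=(b_\sigma(X^u_t,t)+\sigma(t)u(X^u_t,t))\,\mathrm dt+\sigma(t)\,\mathrm dB_t$, for any control $u$. Let $\tilde a=\tilde a(\cdot\,;X)$ be a solution of the lean adjoint ODE $$\frac{\mathrm d}{\mathrm dt}\tilde a(t)=-\nabla_x b_\sigma(X_t,t)^{\top}\tilde a(t)\quad(0<t<1),\qquad \tilde a(1)=-\nabla r(X_1),$$ continuous on $(0,1]$. Let $\chi_t=\kappa_t-\frac{2\eta_t}{\beta_t^2+\alpha_t^2\sigma_1^2}$. Then $\chi$ is integrable on $[t,1]$ for every $t\in(0,1]$, and $$\|\tilde a(t)\|\le\exp\Big(\int_t^1\chi_s\,\mathrm ds\Big)\|\nabla r(X_1)\|,\qquad t\in(0,1].\tag{1}$$ The bound (1) holds also at $t=0$, if $\tilde a$ is continuous at $0$ and $\exp(\int_0^1\chi_s\,\mathrm ds)$, read as $\lim_{t\to0^+}\exp(\int_t^1\chi_s\,\mathrm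 ds)$, exists and is finite. If $p^{\mathrm{base}}=\mathcal N(0,\sigma_1^2\mathrm I)$, then (1) holds with equality, also at $t=0$ under the same conditions. In particular, let $\sigma_0>0$ and let $\bar\alpha:[0,1]\to[0,1]$ be nondecreasing, continuous on $[0,1]$ and differentiable on $(0,1)$, with $\bar\alpha_0=0$, $\bar\alpha_1=1$ and $0<\bar\alpha_t<1$ on $(0,1)$. Then each of the following pairs $(\alpha,\beta)$ satisfies the assumptions above, and, for all $t\in[0,1]$ (with the integral at $t=0$ read as above): (i) Föllmer, $\alpha_t=\bar\alpha_t$, $\beta_t=\sqrt{\bar\alpha_t(1-\bar\alpha_t)}\,\sigma_0$: $\ \exp\big(\int_t^1\chi_s\,\mathrm ds\big)=\dfrac{\sigma_1^2}{(1-\bar\alpha_t)\sigma_0^2+\bar\alpha_t\sigma_1^2}$; (ii) DDPM/DDIM, $\alpha_t=\sqrt{\bar\alpha_t}$, $\beta_t=\sqrt{1-\bar\alpha_t}\,\sigma_0$: $\ \exp\big(\int_t^1\chi_s\,\mathrm ds\big)=\dfrac{\sigma_1^2\sqrt{\bar\alpha_t}}{(1-\bar\alpha_t)\sigma_0^2+\bar\alpha_t\sigma_1^2}$;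 (iii) Rectified Flow, $\alpha_t=\bar\alpha_t$, $\beta_t=(1-\bar\alpha_t)\sigma_0$: $\ \exp\big(\int_t^1\chi_s\,\mathrm ds\big)=\dfrac{\sigma_1^2\,\bar\alpha_t}{(1-\bar\alpha_t)^2\sigma_0^2+\bar\alpha_t^2\sigma_1^2}$, which equals $\dfrac{\bar\alpha_t}{(1-\bar\alpha_t)^2+\bar\alpha_t^2}$ when $\sigma_0=\sigma_1$. -/

import Mathlib

open MeasureTheory Set Filter Topology

noncomputable section

/-- `κ_t = α̇_t / α_t`. -/
def kappa (α : ℝ → ℝ) (t : ℝ) : ℝ := deriv α t / α t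

/-- `η_t = β_t ((α̇_t / α_t) β_t - β̇_t)`. -/
def eta (α β : ℝ → ℝ) (t : ℝ) : ℝ := β t * (kappa α t * β t - deriv β t)

/-- An interpolation schedule `(α, β)` on `[0, 1]` for the stochastic interpolant
`X̄_t = α_t Y + β_t ε`: the coefficients are continuous on `[0, 1]` and differentiable on `(0, 1)`,
with `α_0 = 0`, `α_1 = 1`, `β_1 = 0`; moreover `κ_t = α̇_t / α_t` is defined on `(0, 1)` and
integrable away from `0`, and `η_t = β_t (κ_t β_t - β̇_t)` is nonnegative, so that the noise
schedule `√(2 η_t)` makes sense. (The derivatives are not required to exist at the endpoints: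
`√(1 - t)` and `√(t (1 - t))` are typical `β`. The integrability holds if, for instance, `α` is
nondecreasing, or continuously differentiable on `(0, 1]`.) -/
structure IsSchedule (α β : ℝ → ℝ) : Prop where
  alpha_zero : α 0 = 0
  alpha_one : α 1 = 1
  beta_one : β 1 = 0
  alpha_cont : ContinuousOn α (Icc 0 1)
  beta_cont : ContinuousOn β (Icc 0 1)
  alpha_diff : ∀ t ∈ Ioo (0 : ℝ) 1, DifferentiableAt ℝ α t
  beta_diff : ∀ t ∈ Ioo (0 : ℝ) 1, DifferentiableAt ℝ β t
  alpha_pos : ∀ t ∈ Ioo (0 : ℝ) 1, 0 < α t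
  kappa_int : ∀ t ∈ Ioc (0 : ℝ) 1,
    IntervalIntegrable (kappa α) volume t 1
  eta_nonneg : ∀ t ∈ Ioo (0 : ℝ) 1, 0 ≤ eta α β t

/-- The memoryless noise schedule `σ(t) = √(2 η_t)`. -/
def memorylessNoise (α β : ℝ → ℝ) (t : ℝ) : ℝ := √(2 * eta α β t)

/-- `χ_t = κ_t - 2 η_t / (β_t² + α_t² σ₁²)`. -/
def chi (α β : ℝ → ℝ) (σ₁ : ℝ) (t : ℝ) : ℝ :=
  kappa α t - 2 * eta α β t / (β t ^ 2 + α t ^ 2 * σ₁ ^ 2)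

/-- The density at `x` of the Gaussian `N(m, v I)` on `ℝ^d` (for `v > 0`). -/
def isoGaussianDensity {d : ℕ} (m : EuclideanSpace ℝ (Fin d)) (v : ℝ)
    (x : EuclideanSpace ℝ (Fin d)) : ℝ :=
  Real.exp (-‖x - m‖ ^ 2 / (2 * v)) / (2 * Real.pi * v) ^ ((d : ℝ) / 2)

/-- The density `p_t` of `X̄_t = α_t Y + β_t ε`, where `Y` has density `p` and `ε ~ N(0, I)` is
independent of `Y`: it is `∫ N(x; α_t y, β_t² I) p(y) dy` when `β_t ≠ 0`, and the density of
`α_t Y` when `β_t = 0` (in particular `p_1 = p`). It is used for `α_t > 0`. -/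
def marginalDensity {d : ℕ} (α β : ℝ → ℝ) (p : EuclideanSpace ℝ (Fin d) → ℝ) (t : ℝ)
    (x : EuclideanSpace ℝ (Fin d)) : ℝ :=
  if β t = 0 then p ((α t)⁻¹ • x) / α t ^ d
  else ∫ y, isoGaussianDensity (α t • y) (β t ^ 2) x * p y

/-- The score `𝔰_t = ∇ log p_t`. -/
def score {d : ℕ} (α β : ℝ → ℝ) (p : EuclideanSpace ℝ (Fin d) → ℝ) (t : ℝ)
    (x : EuclideanSpace ℝ (Fin d)) : EuclideanSpace ℝ (Fin d) :=
  gradient (fun z => Real.log (marginalDensity α β p t z)) x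

/-- The base drift `b_σ(x, t) = κ_t x + (σ(t)² / 2 + η_t) 𝔰_t(x)`. -/
def baseDrift {d : ℕ} (α β σ : ℝ → ℝ) (p : EuclideanSpace ℝ (Fin d) → ℝ) (t : ℝ)
    (x : EuclideanSpace ℝ (Fin d)) : EuclideanSpace ℝ (Fin d) :=
  kappa α t • x + (σ t ^ 2 / 2 + eta α β t) • score α β p t x

/-- `p` is an everywhere positive probability density of class `C²` on `ℝ^d`. -/
structure IsPosC2Density {d : ℕ} (p : EuclideanSpace ℝ (Fin d) → ℝ) : Prop where
  pos : ∀ x, 0 < p x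
  contDiff : ContDiff ℝ 2 p
  integral_eq_one : ∫ x, p x = 1

/-- `p` is `γ`-strongly log-concave: `-∇² log p(x) ⪰ γ I` for all `x`. -/
def IsStronglyLogConcave {d : ℕ} (γ : ℝ) (p : EuclideanSpace ℝ (Fin d) → ℝ) : Prop :=
  ∀ x v : EuclideanSpace ℝ (Fin d),
    γ * ‖v‖ ^ 2 ≤ -inner ℝ v (fderiv ℝ (gradient fun y => Real.log (p y)) x v)

/-- `a` is a solution, along the trajectory `X`, of the lean adjoint ODE
`ȧ(t) = -∇_x b_σ(X_t, t)ᵀ a(t)`, `a(1) = -∇r(X_1)`. The equation is imposed on `(0, 1)` only, with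
continuity up to the terminal time, because the coefficients may be singular at `t = 0`
(where `α_0 = 0`) and at `t = 1`. -/
structure IsLeanAdjoint {d : ℕ} (α β σ : ℝ → ℝ) (p r : EuclideanSpace ℝ (Fin d) → ℝ)
    (X a : ℝ → EuclideanSpace ℝ (Fin d)) : Prop where
  cont : ContinuousOn a (Ioc 0 1)
  ode : ∀ t ∈ Ioo (0 : ℝ) 1, HasDerivAt a
    (-(ContinuousLinearMap.adjoint (fderiv ℝ (baseDrift α β σ p t) (X t))) (a t)) t
  terminal : a 1 = -gradient r (X 1)

/-- An admissible `ᾱ` for the Föllmer, DDIM/DDPM and rectified flow schedules: nondecreasing and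
continuous on `[0, 1]`, differentiable on `(0, 1)`, with `ᾱ_0 = 0`, `ᾱ_1 = 1`, and reaching these
two values only at the endpoints (automatic if `ᾱ` is strictly increasing). -/
structure IsAlphaBar (A : ℝ → ℝ) : Prop where
  zero : A 0 = 0
  one : A 1 = 1
  mono : MonotoneOn A (Icc 0 1)
  cont : ContinuousOn A (Icc 0 1)
  diff : ∀ t ∈ Ioo (0 : ℝ) 1, DifferentiableAt ℝ A t
  mem : ∀ t ∈ Ioo (0 : ℝ) 1, A t ∈ Ioo (0 : ℝ) 1

/-- Föllmer schedule: `α = ᾱ`. -/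
def follmerAlpha (A : ℝ → ℝ) (t : ℝ) : ℝ := A t

/-- Föllmer schedule: `β = √(ᾱ (1 - ᾱ)) σ₀`. -/
def follmerBeta (A : ℝ → ℝ) (σ₀ : ℝ) (t : ℝ) : ℝ := √(A t * (1 - A t)) * σ₀

/-- DDIM/DDPM schedule: `α = √ᾱ`. -/
def ddpmAlpha (A : ℝ → ℝ) (t : ℝ) : ℝ := √(A t)

/-- DDIM/DDPM schedule: `β = √(1 - ᾱ) σ₀`. -/
def ddpmBeta (A : ℝ → ℝ) (σ₀ : ℝ) (t : ℝ) : ℝ := √(1 - A t) * σ₀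

/-- Rectified flow schedule: `α = ᾱ`. -/
def rectifiedAlpha (A : ℝ → ℝ) (t : ℝ) : ℝ := A t

/-- Rectified flow schedule: `β = (1 - ᾱ) σ₀`. -/
def rectifiedBeta (A : ℝ → ℝ) (σ₀ : ℝ) (t : ℝ) : ℝ := (1 - A t) * σ₀

/-- `exp (∫_t^1 χ_s ds) = f(t)` for all `t ∈ [0, 1]`, where `χ` is integrable on `[t, 1]` for
`t ∈ (0, 1]`, and the integral from `0` is read as the improper integral
`lim_{t → 0⁺} ∫_t^1 χ_s ds`, possibly `-∞` (in which case its exponential is `0`). -/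
def ExpIntegralEq (χ f : ℝ → ℝ) : Prop :=
  (∀ t ∈ Ioc (0 : ℝ) 1,
    IntervalIntegrable χ volume t 1 ∧ Real.exp (∫ s in t..1, χ s) = f t) ∧
  Tendsto (fun t => Real.exp (∫ s in t..1, χ s)) (𝓝[>] 0) (𝓝 (f 0))

end

/-! Put R = (β² + α²σ₁²)/α. Since β β̇ = κβ² - η, a direct computation gives Ṙ = χR, hence exp(∫_t^1
χ) = R(1)/R(t) = σ₁²/R(t); the three explicit factors are instances of this formula. Along the lean
adjoint ODE the derivative of ‖a‖²R² is 2R²(χ‖a‖² - ⟨a, ∇b a⟩). If ∇b ≤ χ as a quadratic form, then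
‖a‖²R² is nondecreasing, and comparing times t and 1 is the asserted bound. For a centred Gaussian
base density the score is linear, ∇b = χ I, and the quantity is constant, whence equality. The case
t = 0 is a limit.

With memoryless noise the drift is κx + 2η 𝔰_t, so what is needed is ∇𝔰_t ≤ -1/(β² + α²σ₁²): scaling
and Gaussian convolution act on the log-concavity constant as on a variance. The Hessian bound is
first recast as p(y) p(z) ≤ p(m)² exp(-c‖y - z‖²/4), with m the midpoint. This form contains no
derivatives and passes through the convolution integral by the midpoint Prékopa–Leindler inequality
(`lintegral_mul_lintegral_le_sq`), the constants combining by completion of a square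
(`IsMidpointLogConcave.gaussian_mollification`). A second-difference argument then returns to the
Hessian. Where β_t = 0 also η_t = 0, the drift is κx, and the score plays no role. -/

/-! ### The midpoint Prékopa–Leindler inequality. -/

/-- One-dimensional Brunn–Minkowski inequality for compact sets. -/
theorem volume_add_le_of_isCompact {K L C : Set ℝ} (hK : IsCompact K) (hL : IsCompact L)
    (hK0 : K.Nonempty) (hL0 : L.Nonempty) (h : ∀ x ∈ K, ∀ y ∈ L, x + y ∈ C) :
    volume K + volume L ≤ volume C := by
  -- With k = max K and l = min L, the translates K + l and k + L lie in C, on the two sides of k +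
  -- l, and share only that point.
  obtain ⟨k, hkK, hk⟩ := hK.exists_isGreatest hK0
  obtain ⟨l, hlL, hl⟩ := hL.exists_isLeast hL0
  rw [← measure_inter_add_sdiff C (measurableSet_Iic (a := k + l))]
  refine add_le_add ?_ ?_
  · rw [← measure_preimage_add_right volume l (C ∩ Iic (k + l))]
    refine measure_mono fun x hx => ⟨h x hx l hlL, ?_⟩
    simpa using hk hx
  · rw [← measure_preimage_add volume k (C \ Iic (k + l)),
      ← measure_sdiff_null (s := L) (Real.volume_singleton (a := l))]
    refine measure_mono fun y hy => ⟨h k hkK y hy.1, ?_⟩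
    simpa using lt_of_le_of_ne (hl hy.1) (Ne.symm hy.2)

/-- One-dimensional Brunn–Minkowski inequality. -/
theorem volume_add_le {A B C : Set ℝ} (hA : MeasurableSet A) (hB : MeasurableSet B)
    (hA0 : A.Nonempty) (hB0 : B.Nonempty) (h : ∀ x ∈ A, ∀ y ∈ B, x + y ∈ C) :
    volume A + volume B ≤ volume C := by
  obtain ⟨a, ha⟩ := hA0
  obtain ⟨b, hb⟩ := hB0
  rw [hA.measure_eq_iSup_isCompact, hB.measure_eq_iSup_isCompact]
  simp only [iSup_and']
  refine ENNReal.biSup_add_biSup_le' (p := fun K => K ⊆ A ∧ IsCompact K)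
    (q := fun L => L ⊆ B ∧ IsCompact L) ⟨∅, by simp⟩ ⟨∅, by simp⟩ ?_
  rintro K ⟨hKA, hK⟩ L ⟨hLB, hL⟩
  -- The compact approximants may be empty; adding one point of A and one of B makes them nonempty.
  calc volume K + volume L ≤ volume (insert a K) + volume (insert b L) :=
        add_le_add (measure_mono (subset_insert _ _)) (measure_mono (subset_insert _ _))
    _ ≤ volume C := volume_add_le_of_isCompact (hK.insert a) (hL.insert b) (insert_nonempty _ _)
        (insert_nonempty _ _) fun x hx y hy =>
          h x (insert_subset ha hKA hx) y (insert_subset hb hLB hy)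

theorem volume_add_le_two_mul {A B C : Set ℝ} (hA : MeasurableSet A) (hB : MeasurableSet B)
    (hA0 : A.Nonempty) (hB0 : B.Nonempty) (h : ∀ x ∈ A, ∀ y ∈ B, 2⁻¹ * (x + y) ∈ C) :
    volume A + volume B ≤ 2 * volume C := by
  refine (volume_add_le hA hB hA0 hB0 (C := (2⁻¹ * ·) ⁻¹' C) h).trans_eq ?_
  rw [Real.volume_preimage_mul_left (by norm_num)]
  simp

/-- Layer-cake formula plus Brunn–Minkowski on superlevel sets. The common supremum 1 is essential:
for t < 1 both superlevel sets are nonempty, and for t ≥ 1 both are empty. -/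
theorem lintegral_add_le_two_mul {f g h : ℝ → ℝ} (hf : Measurable f) (hg : Measurable g)
    (hh : Measurable h) (f0 : ∀ x, 0 ≤ f x) (g0 : ∀ x, 0 ≤ g x) (h0 : ∀ x, 0 ≤ h x)
    (f1 : ∀ x, f x ≤ 1) (g1 : ∀ x, g x ≤ 1) (fs : ∀ s < 1, ∃ x, s < f x)
    (gs : ∀ s < 1, ∃ x, s < g x) (H : ∀ x y, f x * g y ≤ h (2⁻¹ * (x + y)) ^ 2) :
    (∫⁻ x, ENNReal.ofReal (f x)) + ∫⁻ x, ENNReal.ofReal (g x) ≤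
      2 * ∫⁻ x, ENNReal.ofReal (h x) := by
  rw [lintegral_eq_lintegral_meas_lt volume (ae_of_all _ f0) hf.aemeasurable,
    lintegral_eq_lintegral_meas_lt volume (ae_of_all _ g0) hg.aemeasurable,
    lintegral_eq_lintegral_meas_lt volume (ae_of_all _ h0) hh.aemeasurable]
  have hm : Measurable fun t : ℝ => volume {x | t < f x} :=
    Antitone.measurable fun s t hst => measure_mono fun x hx => lt_of_le_of_lt hst hx
  rw [← lintegral_add_left hm, ← lintegral_const_mul' _ _ (by simp)]
  refine setLIntegral_mono' measurableSet_Ioi fun t (ht : 0 < t) => ?_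
  rcases lt_or_ge t 1 with ht1 | ht1
  · refine volume_add_le_two_mul (measurableSet_lt measurable_const hf)
      (measurableSet_lt measurable_const hg) (fs t ht1) (gs t ht1) ?_
    intro x (hx : t < f x) y (hy : t < g y)
    refine lt_of_pow_lt_pow_left₀ 2 (h0 _) (lt_of_lt_of_le ?_ (H x y))
    rw [sq]
    exact mul_lt_mul'' hx hy ht.le ht.le
  · have e1 : {x | t < f x} = ∅ := by
      ext x; simpa using (f1 x).trans ht1
    have e2 : {x | t < g x} = ∅ := by
      ext x; simpa using (g1 x).trans ht1
    simp [e1, e2]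

theorem ENNReal.mul_le_sq_of_add_le_two_mul {a b c : ENNReal} (h : a + b ≤ 2 * c) :
    a * b ≤ c ^ 2 := by
  rcases eq_or_ne c ⊤ with rfl | hc
  · simp
  have hab : a + b ≠ ⊤ := ne_top_of_le_ne_top (ENNReal.mul_ne_top (by simp) hc) h
  lift c to NNReal using hc
  obtain ⟨ha, hb⟩ := ENNReal.add_ne_top.1 hab
  lift a to NNReal using ha
  lift b to NNReal using hb
  norm_cast at h ⊢
  have h' : (a : ℝ) + b ≤ 2 * c := by exact_mod_cast h
  have : (a : ℝ) * b ≤ c ^ 2 := by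
    nlinarith [sq_nonneg ((a : ℝ) - b), a.coe_nonneg, b.coe_nonneg, c.coe_nonneg]
  exact_mod_cast this

/-- Dividing f and g by their suprema a and b, and h by √(ab), preserves the hypothesis and makes
both suprema 1. The additive inequality then applies, AM–GM makes it multiplicative, and the
normalising constants cancel. A zero supremum makes the left side vanish. -/
theorem lintegral_mul_lintegral_le_of_bounded {f g h : ℝ → ℝ} (hf : Measurable f)
    (hg : Measurable g) (hh : Measurable h) (f0 : ∀ x, 0 ≤ f x) (g0 : ∀ x, 0 ≤ g x)
    (h0 : ∀ x, 0 ≤ h x) (fb : BddAbove (range f)) (gb : BddAbove (range g))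
    (H : ∀ x y, f x * g y ≤ h (2⁻¹ * (x + y)) ^ 2) :
    (∫⁻ x, ENNReal.ofReal (f x)) * ∫⁻ x, ENNReal.ofReal (g x) ≤
      (∫⁻ x, ENNReal.ofReal (h x)) ^ 2 := by
  set a := ⨆ x, f x with ha
  set b := ⨆ x, g x with hb
  have fa : ∀ x, f x ≤ a := le_ciSup fb
  have gb' : ∀ x, g x ≤ b := le_ciSup gb
  rcases (f0 0).trans (fa 0) |>.eq_or_lt with ha0 | ha0
  · have : ∀ x, f x = 0 := fun x => le_antisymm ((fa x).trans ha0.ge) (f0 x)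
    simp [this]
  rcases (g0 0).trans (gb' 0) |>.eq_or_lt with hb0 | hb0
  · have : ∀ x, g x = 0 := fun x => le_antisymm ((gb' x).trans hb0.ge) (g0 x)
    simp [this]
  have hc0 : 0 < √(a * b) := Real.sqrt_pos.2 (mul_pos ha0 hb0)
  have hc2 : √(a * b) ^ 2 = a * b := Real.sq_sqrt (mul_pos ha0 hb0).le
  have key := ENNReal.mul_le_sq_of_add_le_two_mul <| lintegral_add_le_two_mul
    (f := fun x => a⁻¹ * f x) (g := fun x => b⁻¹ * g x) (h := fun x => (√(a * b))⁻¹ * h x)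
    (hf.const_mul _) (hg.const_mul _) (hh.const_mul _)
    (fun x => mul_nonneg (inv_nonneg.2 ha0.le) (f0 x))
    (fun x => mul_nonneg (inv_nonneg.2 hb0.le) (g0 x))
    (fun x => mul_nonneg (inv_nonneg.2 hc0.le) (h0 x))
    (fun x => by rw [inv_mul_le_iff₀ ha0]; simpa using fa x)
    (fun x => by rw [inv_mul_le_iff₀ hb0]; simpa using gb' x)
    (fun s hs => by
      obtain ⟨x, hx⟩ := exists_lt_of_lt_ciSup (f := f) (b := a * s)
        (by rw [← ha]; exact mul_lt_of_lt_one_right ha0 hs)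
      exact ⟨x, by rwa [lt_inv_mul_iff₀ ha0]⟩)
    (fun s hs => by
      obtain ⟨x, hx⟩ := exists_lt_of_lt_ciSup (f := g) (b := b * s)
        (by rw [← hb]; exact mul_lt_of_lt_one_right hb0 hs)
      exact ⟨x, by rwa [lt_inv_mul_iff₀ hb0]⟩)
    (fun x y => by
      rw [mul_pow, inv_pow, hc2, mul_inv]
      calc a⁻¹ * f x * (b⁻¹ * g y) = a⁻¹ * b⁻¹ * (f x * g y) := by ring
        _ ≤ _ := by gcongr; exact H x y)
  simp only [ENNReal.ofReal_mul (inv_nonneg.2 ha0.le), ENNReal.ofReal_mul (inv_nonneg.2 hb0.le),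
    ENNReal.ofReal_mul (inv_nonneg.2 hc0.le)] at key
  rw [lintegral_const_mul' _ _ (by simp), lintegral_const_mul' _ _ (by simp),
    lintegral_const_mul' _ _ (by simp), mul_pow, mul_mul_mul_comm,
    ← ENNReal.ofReal_mul (inv_nonneg.2 ha0.le), ← ENNReal.ofReal_pow (inv_nonneg.2 hc0.le),
    inv_pow, hc2, mul_inv] at key
  exact (ENNReal.mul_le_mul_iff_right (by simp [ha0, hb0]) (by simp)).1 key

/-- Midpoint Prékopa–Leindler inequality on the line. -/
theorem lintegral_mul_lintegral_le_sq_real {f g h : ℝ → ENNReal} (hf : Measurable f)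
    (hg : Measurable g) (hh : Measurable h) (H : ∀ x y, f x * g y ≤ h (2⁻¹ * (x + y)) ^ 2) :
    (∫⁻ x, f x) * ∫⁻ x, g x ≤ (∫⁻ x, h x) ^ 2 := by
  have trunc : ∀ {u : ℝ → ENNReal} (n : ℕ) (x : ℝ),
      ENNReal.ofReal (min (u x) n).toReal = min (u x) n := fun n x =>
    ENNReal.ofReal_toReal (ne_top_of_le_ne_top (ENNReal.natCast_ne_top n) (min_le_right _ _))
  have hbdd : ∀ (u : ℝ → ENNReal) (n : ℕ), BddAbove (range fun x => (min (u x) n).toReal) := by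
    rintro u n
    refine ⟨n, ?_⟩
    rintro _ ⟨x, rfl⟩
    exact (ENNReal.toReal_mono (ENNReal.natCast_ne_top n) (min_le_right _ _)).trans_eq (by simp)
  -- Truncating all three functions at the same level n keeps the hypothesis, because the product of
  -- the truncations is at most both f g and n². Monotone convergence later removes the truncation.
  have step : ∀ n : ℕ, (∫⁻ x, min (f x) n) * ∫⁻ x, min (g x) n ≤ (∫⁻ x, h x) ^ 2 := by
    intro n
    have := lintegral_mul_lintegral_le_of_bounded
      (hf.min measurable_const).ennreal_toReal (hg.min measurable_const).ennreal_toReal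
      (hh.min measurable_const).ennreal_toReal (fun _ => ENNReal.toReal_nonneg)
      (fun _ => ENNReal.toReal_nonneg) (fun _ => ENNReal.toReal_nonneg) (hbdd f n) (hbdd g n)
      (h := fun x => (min (h x) n).toReal) (fun x y => by
        rw [← ENNReal.toReal_mul, ← ENNReal.toReal_pow]
        refine ENNReal.toReal_mono (ENNReal.pow_ne_top
          (ne_top_of_le_ne_top (ENNReal.natCast_ne_top n) (min_le_right _ _))) ?_
        rcases le_total (h (2⁻¹ * (x + y))) n with hn | hn
        · rw [min_eq_left hn]
          exact (mul_le_mul' (min_le_left _ _) (min_le_left _ _)).trans (H x y)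
        · rw [min_eq_right hn, sq]
          exact mul_le_mul' (min_le_right _ _) (min_le_right _ _))
    simp only [trunc] at this
    refine this.trans ?_
    gcongr
    exact min_le_left _ _
  have sup : ∀ {u : ℝ → ENNReal}, Measurable u → ∫⁻ x, u x = ⨆ n : ℕ, ∫⁻ x, min (u x) n := by
    intro u hu
    rw [← lintegral_iSup (fun n => hu.min measurable_const)
      (fun m n hmn x => min_le_min_left _ (by exact_mod_cast hmn))]
    refine lintegral_congr fun x => ?_
    rw [← inf_iSup_eq, ENNReal.iSup_natCast, inf_top_eq]
  rw [sup hf, sup hg, ENNReal.iSup_mul]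
  refine iSup_le fun m => ?_
  rw [ENNReal.mul_iSup]
  refine iSup_le fun n => (le_trans ?_ (step (max m n)))
  gcongr <;> simp

/-- Midpoint Prékopa–Leindler inequality. -/
theorem lintegral_mul_lintegral_le_sq_pi {n : ℕ} {f g h : (Fin n → ℝ) → ENNReal}
    (hf : Measurable f) (hg : Measurable g) (hh : Measurable h)
    (H : ∀ x y, f x * g y ≤ h ((2⁻¹ : ℝ) • (x + y)) ^ 2) :
    (∫⁻ x, f x) * ∫⁻ x, g x ≤ (∫⁻ x, h x) ^ 2 := by
  induction n with
  | zero =>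
    simp only [Measure.volume_pi_eq_dirac 0, lintegral_dirac]
    convert H 0 0
  | succ n ih =>
    let e := (MeasurableEquiv.piFinSuccAbove (fun _ : Fin (n + 1) => ℝ) 0).symm
    have he : MeasurePreserving e :=
      (volume_preserving_piFinSuccAbove (fun _ : Fin (n + 1) => ℝ) 0).symm _
    have fub : ∀ {u : (Fin (n + 1) → ℝ) → ENNReal}, Measurable u →
        ∫⁻ x, u x = ∫⁻ s : ℝ, ∫⁻ z : Fin n → ℝ, u (e (s, z)) := by
      intro u hu
      rw [← he.lintegral_comp hu]
      exact lintegral_prod _ (hu.comp e.measurable).aemeasurable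
    have hlin : ∀ (s t : ℝ) (z w : Fin n → ℝ),
        (2⁻¹ : ℝ) • (e (s, z) + e (t, w)) = e (2⁻¹ * (s + t), (2⁻¹ : ℝ) • (z + w)) := by
      intro s t z w
      ext i
      refine Fin.cases ?_ (fun j => ?_) i <;>
        simp [e, MeasurableEquiv.piFinSuccAbove, Fin.insertNthEquiv, mul_add]
    -- By Tonelli, it suffices to apply the one-dimensional inequality to the integrals over the
    -- slices; its hypothesis at (s, t) is the induction hypothesis for the slices at s, t and their
    -- midpoint.
    rw [fub hf, fub hg, fub hh]
    refine lintegral_mul_lintegral_le_sq_real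
      (hf.comp e.measurable).lintegral_prod_right' (hg.comp e.measurable).lintegral_prod_right'
      (hh.comp e.measurable).lintegral_prod_right' fun s t => ?_
    refine ih ((hf.comp e.measurable).comp measurable_prodMk_left)
      ((hg.comp e.measurable).comp measurable_prodMk_left)
      ((hh.comp e.measurable).comp measurable_prodMk_left) fun z w => ?_
    simpa [hlin] using H (e (s, z)) (e (t, w))

theorem lintegral_mul_lintegral_le_sq {n : ℕ} {f g h : EuclideanSpace ℝ (Fin n) → ENNReal}
    (hf : Measurable f) (hg : Measurable g) (hh : Measurable h)
    (H : ∀ x y, f x * g y ≤ h ((2⁻¹ : ℝ) • (x + y)) ^ 2) :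
    (∫⁻ x, f x) * ∫⁻ x, g x ≤ (∫⁻ x, h x) ^ 2 := by
  have hm := PiLp.volume_preserving_toLp (Fin n)
  rw [← hm.lintegral_comp hf, ← hm.lintegral_comp hg, ← hm.lintegral_comp hh]
  refine lintegral_mul_lintegral_le_sq_pi (hf.comp hm.measurable) (hg.comp hm.measurable)
    (hh.comp hm.measurable) fun x y => ?_
  simpa using H (WithLp.toLp 2 x) (WithLp.toLp 2 y)

/-! ### Hessian bounds versus midpoint concavity. -/

section LogConcave

variable {d : ℕ}

theorem gradient_apply_eq_fderiv (F : EuclideanSpace ℝ (Fin d) → ℝ) (x : EuclideanSpace ℝ (Fin d))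
    (i : Fin d) : gradient F x i = fderiv ℝ F x (EuclideanSpace.single i 1) := by
  rw [← inner_gradient_left, EuclideanSpace.inner_single_right]
  simp

theorem differentiableAt_gradient {F : EuclideanSpace ℝ (Fin d) → ℝ}
    {x : EuclideanSpace ℝ (Fin d)} (h : ∀ e, DifferentiableAt ℝ (fun z => fderiv ℝ F z e) x) :
    DifferentiableAt ℝ (gradient F) x := by
  rw [differentiableAt_euclidean]
  intro i
  simp only [gradient_apply_eq_fderiv]
  exact h _

theorem hasDerivAt_comp_line {F : EuclideanSpace ℝ (Fin d) → ℝ} (hF : Differentiable ℝ F)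
    (x v : EuclideanSpace ℝ (Fin d)) (s : ℝ) :
    HasDerivAt (fun s : ℝ => F (x + s • v)) (inner ℝ (gradient F (x + s • v)) v) s := by
  have h1 : HasDerivAt (fun s : ℝ => x + s • v) v s := by
    simpa using ((hasDerivAt_id s).smul_const v).const_add x
  have := (hF (x + s • v)).hasFDerivAt.comp_hasDerivAt s h1
  rwa [← inner_gradient_left] at this

theorem hasDerivAt_inner_gradient_line {F : EuclideanSpace ℝ (Fin d) → ℝ}
    {x v : EuclideanSpace ℝ (Fin d)} {s : ℝ} (hF : DifferentiableAt ℝ (gradient F) (x + s • v)) :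
    HasDerivAt (fun s : ℝ => inner ℝ (gradient F (x + s • v)) v)
      (inner ℝ v (fderiv ℝ (gradient F) (x + s • v) v)) s := by
  have h1 : HasDerivAt (fun s : ℝ => x + s • v) v s := by
    simpa using ((hasDerivAt_id s).smul_const v).const_add x
  have h2 := (hF.hasFDerivAt.comp_hasDerivAt s h1).inner ℝ (hasDerivAt_const s v)
  simpa [real_inner_comm] using h2

/-- A quantitative midpoint concavity inequality implies the corresponding Hessian bound. -/
theorem inner_fderiv_gradient_le {F : EuclideanSpace ℝ (Fin d) → ℝ} {c : ℝ}
    (hF : Differentiable ℝ F) {x : EuclideanSpace ℝ (Fin d)}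
    (hG : DifferentiableAt ℝ (gradient F) x)
    (hmid : ∀ y z, F y + F z + c / 4 * ‖y - z‖ ^ 2 ≤ 2 * F ((2⁻¹ : ℝ) • (y + z)))
    (v : EuclideanSpace ℝ (Fin d)) :
    inner ℝ v (fderiv ℝ (gradient F) x v) ≤ -c * ‖v‖ ^ 2 := by
  set q := inner ℝ v (fderiv ℝ (gradient F) x v) with hq
  set G : ℝ → ℝ := fun s => inner ℝ (gradient F (x + s • v)) v with hGdef
  -- The corrected symmetric second difference: it is nonpositive, vanishes at 0, and has second
  -- derivative 2q + 2c‖v‖² there.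
  let ψ : ℝ → ℝ := fun s => F (x + s • v) + F (x + (-s) • v) - 2 * F x + c * ‖v‖ ^ 2 * s ^ 2
  have hψ0 : ψ 0 = 0 := by simp [ψ]; ring
  have hψle : ∀ s, ψ s ≤ 0 := by
    intro s
    have h := hmid (x + s • v) (x + (-s) • v)
    have e1 : x + s • v - (x + (-s) • v) = (2 * s) • v := by module
    have e2 : (2⁻¹ : ℝ) • (x + s • v + (x + (-s) • v)) = x := by module
    rw [e1, e2, norm_smul, mul_pow, Real.norm_eq_abs, sq_abs] at h
    simp only [ψ]
    linarith
  have hψ' : ∀ s, HasDerivAt ψ (G s - G (-s) + c * ‖v‖ ^ 2 * (2 * s)) s := by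
    intro s
    have h1 := hasDerivAt_comp_line hF x v s
    have h2 := (hasDerivAt_comp_line hF x v (-s)).comp s (hasDerivAt_neg s)
    have h3 := ((hasDerivAt_id s).pow 2).const_mul (c * ‖v‖ ^ 2)
    refine HasDerivAt.congr_deriv (f := ψ) (((h1.add h2).sub_const (2 * F x)).add h3) ?_
    simp only [hGdef, id, Nat.cast_ofNat]
    ring
  have hd : deriv ψ = fun s => G s - G (-s) + c * ‖v‖ ^ 2 * (2 * s) :=
    funext fun s => (hψ' s).deriv
  have hd2 : HasDerivAt (deriv ψ) (2 * q + 2 * c * ‖v‖ ^ 2) 0 := by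
    rw [hd]
    have h1 : HasDerivAt G q 0 := by
      have := hasDerivAt_inner_gradient_line (s := 0) (v := v) (x := x) (by simpa using hG)
      rwa [zero_smul, add_zero] at this
    have h2 : HasDerivAt (fun s => G (-s)) (q * -1) 0 := by
      refine HasDerivAt.comp (0 : ℝ) (h₂ := G) ?_ (hasDerivAt_neg 0)
      simpa using h1
    have h3 := ((hasDerivAt_id (0 : ℝ)).const_mul 2).const_mul (c * ‖v‖ ^ 2)
    refine HasDerivAt.congr_deriv ((h1.sub h2).add h3) ?_
    ring
  -- A positive second derivative would make 0 a local minimum of ψ ≤ 0, so ψ would vanish near 0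
  -- and its second derivative with it.
  by_contra! hlt
  have hpos : 0 < deriv (deriv ψ) 0 := by rw [hd2.deriv]; linarith
  have hmin := isLocalMin_of_deriv_deriv_pos hpos (by rw [hd]; simp) (hψ' 0).continuousAt
  have hzero : ψ =ᶠ[𝓝 0] fun _ => 0 := by
    filter_upwards [hmin] with s hs
    exact le_antisymm (hψle s) (hψ0 ▸ hs)
  have : deriv (deriv ψ) 0 = 0 := by
    rw [(hzero.deriv).deriv_eq]
    simp
  exact hpos.ne' this

/-- A Hessian upper bound implies the corresponding quantitative midpoint concavity. -/
theorem midpoint_le_of_hessian_le {F : EuclideanSpace ℝ (Fin d) → ℝ} {c : ℝ}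
    (hF : Differentiable ℝ F) (hG : Differentiable ℝ (gradient F))
    (h : ∀ x v, c * ‖v‖ ^ 2 ≤ -inner ℝ v (fderiv ℝ (gradient F) x v))
    (y z : EuclideanSpace ℝ (Fin d)) :
    F y + F z + c / 4 * ‖y - z‖ ^ 2 ≤ 2 * F ((2⁻¹ : ℝ) • (y + z)) := by
  set m := (2⁻¹ : ℝ) • (y + z) with hm
  set w := (2⁻¹ : ℝ) • (y - z) with hw
  -- The endpoints y and z are s = 1 and s = -1. The quadratic term uses up exactly the assumed
  -- Hessian bound, so ψ is concave.
  let ψ : ℝ → ℝ := fun s => F (m + s • w) + c * ‖w‖ ^ 2 / 2 * s ^ 2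
  let ψ' : ℝ → ℝ := fun s => inner ℝ (gradient F (m + s • w)) w + c * ‖w‖ ^ 2 * s
  have h1 : ∀ s, HasDerivAt ψ (ψ' s) s := by
    intro s
    refine HasDerivAt.congr_deriv (f := ψ) ((hasDerivAt_comp_line hF m w s).add
      (((hasDerivAt_id s).pow 2).const_mul (c * ‖w‖ ^ 2 / 2))) ?_
    simp only [ψ', id, Nat.cast_ofNat]
    ring
  have h2 : ∀ s, HasDerivAt ψ'
      (inner ℝ w (fderiv ℝ (gradient F) (m + s • w) w) + c * ‖w‖ ^ 2) s := by
    intro s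
    refine HasDerivAt.congr_deriv (f := ψ')
      ((hasDerivAt_inner_gradient_line (hG (m + s • w))).add
        ((hasDerivAt_id s).const_mul (c * ‖w‖ ^ 2))) ?_
    ring
  have hconc : ConcaveOn ℝ univ ψ := by
    have e : deriv ψ = ψ' := funext fun s => (h1 s).deriv
    refine AntitoneOn.concaveOn_of_deriv convex_univ
      (fun s _ => (h1 s).continuousAt.continuousWithinAt)
      (fun s _ => (h1 s).differentiableAt.differentiableWithinAt) ?_
    rw [e]
    refine (antitone_of_deriv_nonpos (fun s => (h2 s).differentiableAt) fun s => ?_).antitoneOn _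
    rw [(h2 s).deriv]
    linarith [h (m + s • w) w]
  have := hconc.2 (mem_univ 1) (mem_univ (-1)) (by norm_num : (0 : ℝ) ≤ 2⁻¹)
    (by norm_num : (0 : ℝ) ≤ 2⁻¹) (by norm_num)
  have ey : m + (1 : ℝ) • w = y := by rw [hm, hw]; module
  have ez : m + (-1 : ℝ) • w = z := by rw [hm, hw]; module
  have e0 : (2⁻¹ : ℝ) • (1 : ℝ) + (2⁻¹ : ℝ) • (-1 : ℝ) = 0 := by norm_num
  have ew : ‖w‖ ^ 2 = ‖y - z‖ ^ 2 / 4 := by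
    rw [hw, norm_smul]; norm_num; ring
  rw [e0] at this
  simp only [ψ, ey, ez, zero_smul, add_zero, smul_eq_mul, ew] at this
  linarith

theorem differentiable_gradient_of_contDiff {F : EuclideanSpace ℝ (Fin d) → ℝ}
    (hF : ContDiff ℝ 2 F) : Differentiable ℝ (gradient F) := by
  have h1 : Differentiable ℝ (fderiv ℝ F) :=
    (hF.fderiv_right (m := 1) (by norm_num)).differentiable (by norm_num)
  exact fun x => differentiableAt_gradient fun e => (h1 x).clm_apply (differentiableAt_const e)

/-- Quantitative midpoint log-concavity of a positive function. -/
def IsMidpointLogConcave (c : ℝ) (p : EuclideanSpace ℝ (Fin d) → ℝ) : Prop :=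
  ∀ y z, p y * p z ≤ p ((2⁻¹ : ℝ) • (y + z)) ^ 2 * Real.exp (-(c / 4 * ‖y - z‖ ^ 2))

theorem IsStronglyLogConcave.isMidpointLogConcave {γ : ℝ} {p : EuclideanSpace ℝ (Fin d) → ℝ}
    (h : IsStronglyLogConcave γ p) (hp : IsPosC2Density p) : IsMidpointLogConcave γ p := by
  intro y z
  have hF : ContDiff ℝ 2 fun y => Real.log (p y) := hp.contDiff.log fun x => (hp.pos x).ne'
  have := midpoint_le_of_hessian_le (hF.differentiable (by norm_num))
    (differentiable_gradient_of_contDiff hF) h y z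
  set m := (2⁻¹ : ℝ) • (y + z)
  calc p y * p z = Real.exp (Real.log (p y) + Real.log (p z)) := by
        rw [Real.exp_add, Real.exp_log (hp.pos y), Real.exp_log (hp.pos z)]
    _ ≤ Real.exp (2 * Real.log (p m) + -(γ / 4 * ‖y - z‖ ^ 2)) :=
        Real.exp_le_exp.2 (by linarith)
    _ = _ := by
        rw [Real.exp_add, two_mul, Real.exp_add, Real.exp_log (hp.pos m), sq (p m)]

theorem IsMidpointLogConcave.inner_fderiv_gradient_log_le {c : ℝ}
    {p : EuclideanSpace ℝ (Fin d) → ℝ} (h : IsMidpointLogConcave c p) (hpos : ∀ x, 0 < p x)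
    (hp : Differentiable ℝ p) {x : EuclideanSpace ℝ (Fin d)}
    (hG : DifferentiableAt ℝ (gradient fun y => Real.log (p y)) x)
    (v : EuclideanSpace ℝ (Fin d)) :
    inner ℝ v (fderiv ℝ (gradient fun y => Real.log (p y)) x v) ≤ -c * ‖v‖ ^ 2 := by
  refine inner_fderiv_gradient_le (hp.log fun x => (hpos x).ne') hG (fun y z => ?_) v
  have h1 := Real.log_le_log (mul_pos (hpos y) (hpos z)) (h y z)
  rw [Real.log_mul (hpos y).ne' (hpos z).ne',
    Real.log_mul (pow_ne_zero _ (hpos _).ne') (Real.exp_pos _).ne', Real.log_pow,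
    Real.log_exp] at h1
  push_cast at h1
  linarith

theorem differentiableAt_gradient_log {p : EuclideanSpace ℝ (Fin d) → ℝ} (hpos : ∀ x, 0 < p x)
    (hp : Differentiable ℝ p) (hp' : ∀ e, Differentiable ℝ fun z => fderiv ℝ p z e)
    (x : EuclideanSpace ℝ (Fin d)) :
    DifferentiableAt ℝ (gradient fun y => Real.log (p y)) x := by
  refine differentiableAt_gradient fun e => ?_
  have : (fun z => fderiv ℝ (fun y => Real.log (p y)) z e) =
      fun z => (p z)⁻¹ * fderiv ℝ p z e := by
    ext z
    rw [fderiv.log (hp z) (hpos z).ne']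
    simp
  rw [this]
  exact ((hp x).inv (hpos x).ne').mul (hp' e x)

end LogConcave

/-! ### Smoothness of Gaussian mollifications. -/

section Mollification

variable {E : Type*} [NormedAddCommGroup E] [InnerProductSpace ℝ E]

/-- This is u ≤ exp u at u = s²/(2v). Such uniform kernel bounds let all derivatives fall on the
Gaussian, so that integrability of p alone provides domination. -/
theorem exp_neg_sq_mul_sq_le {v : ℝ} (hv : 0 < v) (s : ℝ) :
    Real.exp (-s ^ 2 / (2 * v)) * s ^ 2 ≤ 2 * v := by
  have h1 : s ^ 2 / (2 * v) ≤ Real.exp (s ^ 2 / (2 * v)) := by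
    linarith [Real.add_one_le_exp (s ^ 2 / (2 * v))]
  rw [neg_div, Real.exp_neg, inv_mul_le_iff₀ (Real.exp_pos _)]
  rwa [div_le_iff₀ (by positivity)] at h1

theorem exp_neg_sq_le_one {v : ℝ} (hv : 0 < v) (s : ℝ) : Real.exp (-s ^ 2 / (2 * v)) ≤ 1 := by
  rw [Real.exp_le_one_iff, neg_div]
  exact neg_nonpos.2 (by positivity)

theorem norm_exp_neg_norm_sq_le {E : Type*} [NormedAddCommGroup E] {v : ℝ} (hv : 0 < v) (z : E) :
    ‖Real.exp (-‖z‖ ^ 2 / (2 * v))‖ ≤ 1 := by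
  rw [Real.norm_eq_abs, Real.abs_exp]
  exact exp_neg_sq_le_one hv _

theorem exp_neg_sq_mul_le {v : ℝ} (hv : 0 < v) (s : ℝ) :
    Real.exp (-s ^ 2 / (2 * v)) * s ≤ 1 + 2 * v := by
  have h1 := exp_neg_sq_mul_sq_le hv s
  have h2 := exp_neg_sq_le_one hv s
  have h3 : s ≤ 1 + s ^ 2 := by nlinarith [sq_nonneg (s - 1)]
  have h4 := mul_le_mul_of_nonneg_left h3 (Real.exp_pos (-s ^ 2 / (2 * v))).le
  linarith

theorem hasFDerivAt_exp_neg_norm_sq (v : ℝ) (z : E) :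
    HasFDerivAt (fun z : E => Real.exp (-‖z‖ ^ 2 / (2 * v)))
      ((-(Real.exp (-‖z‖ ^ 2 / (2 * v)) / v)) • innerSL ℝ z) z := by
  have h1 : HasFDerivAt (fun z : E => -‖z‖ ^ 2 / (2 * v))
      ((2 * v)⁻¹ • -((2 : ℕ) • innerSL ℝ z)) z := by
    simpa only [div_eq_mul_inv] using
      (hasStrictFDerivAt_norm_sq z).hasFDerivAt.fun_neg.mul_const (2 * v)⁻¹
  refine h1.exp.congr_fderiv ?_
  ext w
  simp only [smul_apply, neg_apply, innerSL_apply_apply, smul_eq_mul, nsmul_eq_mul, div_eq_mul_inv,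
    mul_inv, Nat.cast_ofNat]
  ring

theorem norm_fderiv_exp_neg_norm_sq_le {v : ℝ} (hv : 0 < v) (z : E) :
    ‖(-(Real.exp (-‖z‖ ^ 2 / (2 * v)) / v)) • innerSL ℝ z‖ ≤ (1 + 2 * v) / v := by
  rw [norm_smul, innerSL_apply_norm, norm_neg, Real.norm_eq_abs, abs_of_pos (by positivity),
    div_mul_eq_mul_div]
  gcongr
  exact exp_neg_sq_mul_le hv _

theorem hasFDerivAt_exp_neg_norm_sq_mul_inner (v : ℝ) (e z : E) :
    HasFDerivAt (fun z : E => Real.exp (-‖z‖ ^ 2 / (2 * v)) * inner ℝ z e)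
      (Real.exp (-‖z‖ ^ 2 / (2 * v)) • innerSL ℝ e +
        (inner ℝ z e : ℝ) • ((-(Real.exp (-‖z‖ ^ 2 / (2 * v)) / v)) • innerSL ℝ z)) z := by
  have h1 : HasFDerivAt (fun z : E => (inner ℝ z e : ℝ)) (innerSL ℝ e) z := by
    simpa [real_inner_comm] using (innerSL ℝ e).hasFDerivAt (x := z)
  exact (hasFDerivAt_exp_neg_norm_sq v z).mul h1

theorem norm_fderiv_exp_neg_norm_sq_mul_inner_le {v : ℝ} (hv : 0 < v) (e z : E) :
    ‖Real.exp (-‖z‖ ^ 2 / (2 * v)) • innerSL ℝ e +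
        (inner ℝ z e : ℝ) • ((-(Real.exp (-‖z‖ ^ 2 / (2 * v)) / v)) • innerSL ℝ z)‖ ≤
      3 * ‖e‖ := by
  refine (norm_add_le _ _).trans ?_
  rw [norm_smul, norm_smul, norm_smul, innerSL_apply_norm, innerSL_apply_norm, norm_neg,
    Real.norm_eq_abs, Real.norm_eq_abs, Real.norm_eq_abs, abs_of_pos (Real.exp_pos _),
    abs_of_pos (div_pos (Real.exp_pos _) hv)]
  have h1 := exp_neg_sq_le_one hv ‖z‖
  have h2 := exp_neg_sq_mul_sq_le hv ‖z‖
  have h3 := abs_real_inner_le_norm z e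
  set k := Real.exp (-‖z‖ ^ 2 / (2 * v))
  have hk : 0 ≤ k := (Real.exp_pos _).le
  have h4 : |inner ℝ z e| * (k / v * ‖z‖) ≤ ‖z‖ * ‖e‖ * (k / v * ‖z‖) := by gcongr
  have h5 : ‖z‖ * ‖e‖ * (k / v * ‖z‖) = k * ‖z‖ ^ 2 / v * ‖e‖ := by ring
  have h6 : k * ‖z‖ ^ 2 / v * ‖e‖ ≤ 2 * ‖e‖ := by
    gcongr
    rwa [div_le_iff₀ hv]
  have h7 : k * ‖e‖ ≤ 1 * ‖e‖ := by gcongr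
  linarith

variable [MeasurableSpace E] [BorelSpace E]

theorem integrable_bounded_comp_sub_mul {μ : Measure E} {k : E → ℝ} {p : E → ℝ}
    (hp : Integrable p μ) (a : ℝ) {C : ℝ} (hk : Continuous k) (hkC : ∀ z, ‖k z‖ ≤ C) (x : E) :
    Integrable (fun y => k (x - a • y) * p y) μ := by
  refine (hp.norm.const_mul C).mono' ((Continuous.aestronglyMeasurable (by fun_prop)).mul hp.1)
    (ae_of_all _ fun y => ?_)
  rw [norm_mul]
  gcongr
  exact hkC _

variable [FiniteDimensional ℝ E]

/-- Differentiation under the integral sign of `∫ k (x - a y) p y dy` for `k` with bounded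
derivative. -/
theorem hasFDerivAt_integral_comp_sub_mul {μ : Measure E} {k : E → ℝ} {k' : E → E →L[ℝ] ℝ}
    {p : E → ℝ} (hp : Integrable p μ) (a : ℝ) {C₀ C : ℝ} (hk : ∀ z, HasFDerivAt k (k' z) z)
    (hk'c : Continuous k') (hk0 : ∀ z, ‖k z‖ ≤ C₀) (hkC : ∀ z, ‖k' z‖ ≤ C) (x : E) :
    HasFDerivAt (fun x => ∫ y, k (x - a • y) * p y ∂μ) (∫ y, p y • k' (x - a • y) ∂μ) x := by
  have hkc : Continuous k := continuous_iff_continuousAt.2 fun z => (hk z).continuousAt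
  have hmeas : ∀ x, AEStronglyMeasurable (fun y => k (x - a • y) * p y) μ := fun x =>
    (Continuous.aestronglyMeasurable (by fun_prop)).mul hp.1
  refine hasFDerivAt_integral_of_dominated_of_fderiv_le (bound := fun y => C * ‖p y‖)
    (F := fun x y => k (x - a • y) * p y) (F' := fun x y => p y • k' (x - a • y)) univ_mem
    (Eventually.of_forall hmeas) ?_ ?_ ?_ (hp.norm.const_mul C) ?_
  · refine (hp.norm.const_mul C₀).mono' (hmeas x) (ae_of_all _ fun y => ?_)
    rw [norm_mul]
    gcongr
    exact hk0 _
  · exact hp.1.smul (Continuous.aestronglyMeasurable (by fun_prop))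
  · refine ae_of_all _ fun y x _ => ?_
    rw [norm_smul, mul_comm]
    gcongr
    exact hkC _
  · refine ae_of_all _ fun y x _ => ?_
    have h1 : HasFDerivAt (fun x => x - a • y) (ContinuousLinearMap.id ℝ E) x :=
      (hasFDerivAt_id x).sub_const _
    simpa using ((hk (x - a • y)).comp x h1).mul_const (p y)

variable {μ : Measure E} {p : E → ℝ} {v : ℝ}

theorem hasFDerivAt_gaussian_mollification (hp : Integrable p μ) (a : ℝ) (hv : 0 < v) (x : E) :
    HasFDerivAt (fun x => ∫ y, Real.exp (-‖x - a • y‖ ^ 2 / (2 * v)) * p y ∂μ)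
      (∫ y, p y • ((-(Real.exp (-‖x - a • y‖ ^ 2 / (2 * v)) / v)) • innerSL ℝ (x - a • y)) ∂μ)
      x :=
  hasFDerivAt_integral_comp_sub_mul hp a (hasFDerivAt_exp_neg_norm_sq v)
    ((by fun_prop : Continuous fun z : E => -(Real.exp (-‖z‖ ^ 2 / (2 * v)) / v)).smul
      (innerSL ℝ (E := E)).continuous) (norm_exp_neg_norm_sq_le hv)
    (norm_fderiv_exp_neg_norm_sq_le hv) x

/-- The directional derivative is again an integral against p of a scalar kernel in x - a y, so the
same differentiation lemma yields the second derivative. -/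
theorem fderiv_gaussian_mollification_apply (hp : Integrable p μ) (a : ℝ) (hv : 0 < v)
    (x e : E) :
    fderiv ℝ (fun x => ∫ y, Real.exp (-‖x - a • y‖ ^ 2 / (2 * v)) * p y ∂μ) x e =
      -v⁻¹ * ∫ y, Real.exp (-‖x - a • y‖ ^ 2 / (2 * v)) * inner ℝ (x - a • y) e * p y ∂μ := by
  rw [(hasFDerivAt_gaussian_mollification hp a hv x).fderiv, ContinuousLinearMap.integral_apply,
    ← integral_const_mul]
  · refine integral_congr_ae (ae_of_all _ fun y => ?_)
    simp only [smul_apply, innerSL_apply_apply, smul_eq_mul]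
    ring
  · refine (hp.norm.const_mul ((1 + 2 * v) / v)).mono' (hp.1.smul ?_) (ae_of_all _ fun y => ?_)
    · exact Continuous.aestronglyMeasurable <|
        (by fun_prop : Continuous fun y : E => -(Real.exp (-‖x - a • y‖ ^ 2 / (2 * v)) / v)).smul
          ((innerSL ℝ (E := E)).continuous.comp (by fun_prop))
    · rw [norm_smul, mul_comm]
      gcongr
      exact norm_fderiv_exp_neg_norm_sq_le hv _

theorem differentiable_fderiv_gaussian_mollification (hp : Integrable p μ) (a : ℝ) (hv : 0 < v)
    (e : E) :
    Differentiable ℝ fun x =>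
      fderiv ℝ (fun x => ∫ y, Real.exp (-‖x - a • y‖ ^ 2 / (2 * v)) * p y ∂μ) x e := by
  simp only [fderiv_gaussian_mollification_apply hp a hv]
  intro x
  refine ((hasFDerivAt_integral_comp_sub_mul hp a
    (hasFDerivAt_exp_neg_norm_sq_mul_inner v e) ?_ (C₀ := (1 + 2 * v) * ‖e‖) (fun z => ?_)
    (norm_fderiv_exp_neg_norm_sq_mul_inner_le hv e) x).const_mul (-v⁻¹)).differentiableAt
  · have h1 : Continuous fun z : E => innerSL ℝ z := (innerSL ℝ (E := E)).continuous
    fun_prop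
  · rw [norm_mul, Real.norm_eq_abs, Real.abs_exp, Real.norm_eq_abs]
    calc Real.exp (-‖z‖ ^ 2 / (2 * v)) * |inner ℝ z e|
        ≤ Real.exp (-‖z‖ ^ 2 / (2 * v)) * (‖z‖ * ‖e‖) := by
          gcongr
          exact abs_real_inner_le_norm z e
      _ = Real.exp (-‖z‖ ^ 2 / (2 * v)) * ‖z‖ * ‖e‖ := by ring
      _ ≤ _ := by
          gcongr
          exact exp_neg_sq_mul_le hv _

end Mollification

/-! ### The marginal density and its score. -/

section Marginal

variable {d : ℕ} {p : EuclideanSpace ℝ (Fin d) → ℝ}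

theorem IsPosC2Density.integrable (hp : IsPosC2Density p) : Integrable p :=
  Integrable.of_integral_ne_zero (by rw [hp.integral_eq_one]; exact one_ne_zero)

theorem isoGaussianDensity_pos (m : EuclideanSpace ℝ (Fin d)) {v : ℝ} (hv : 0 < v)
    (x : EuclideanSpace ℝ (Fin d)) : 0 < isoGaussianDensity m v x :=
  div_pos (Real.exp_pos _) (Real.rpow_pos_of_pos (by positivity) _)

theorem marginalDensity_eq {α β : ℝ → ℝ} {t : ℝ} (hβ : β t ≠ 0) :
    marginalDensity α β p t = fun x => ((2 * Real.pi * β t ^ 2) ^ ((d : ℝ) / 2))⁻¹ *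
      ∫ y, Real.exp (-‖x - α t • y‖ ^ 2 / (2 * β t ^ 2)) * p y := by
  ext x
  rw [marginalDensity, if_neg hβ, ← integral_const_mul]
  refine integral_congr_ae (ae_of_all _ fun y => ?_)
  simp only [isoGaussianDensity]
  ring

theorem integrable_exp_neg_norm_sq_mul (hp : Integrable p) (a : ℝ) {v : ℝ} (hv : 0 < v)
    (x : EuclideanSpace ℝ (Fin d)) :
    Integrable fun y => Real.exp (-‖x - a • y‖ ^ 2 / (2 * v)) * p y :=
  integrable_bounded_comp_sub_mul hp a (by fun_prop) (norm_exp_neg_norm_sq_le hv) x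

theorem gaussian_mollification_pos (hp : Integrable p) (hpos : ∀ x, 0 < p x) (a : ℝ) {v : ℝ}
    (hv : 0 < v) (x : EuclideanSpace ℝ (Fin d)) :
    0 < ∫ y, Real.exp (-‖x - a • y‖ ^ 2 / (2 * v)) * p y := by
  have h : ∀ y, 0 < Real.exp (-‖x - a • y‖ ^ 2 / (2 * v)) * p y := fun y =>
    mul_pos (Real.exp_pos _) (hpos y)
  rw [integral_pos_iff_support_of_nonneg (fun y => (h y).le)
    (integrable_exp_neg_norm_sq_mul hp a hv x)]
  have : (Function.support fun y => Real.exp (-‖x - a • y‖ ^ 2 / (2 * v)) * p y) = univ :=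
    eq_univ_of_forall fun y => (h y).ne'
  rw [this]
  exact Measure.measure_univ_pos.2 (NeZero.ne _)

/-- The difference of the two sides is a perfect square over a positive denominator. This is where
the variances v and a²s add up. -/
theorem mul_norm_sq_le_of_inv_add {E : Type*} [NormedAddCommGroup E] [InnerProductSpace ℝ E]
    {a v s : ℝ} (hv : 0 < v) (hs : 0 < s) (x y : E) :
    1 / (v + a ^ 2 * s) * ‖x‖ ^ 2 ≤ ‖x - a • y‖ ^ 2 / v + 1 / s * ‖y‖ ^ 2 := by
  have hS : 0 < v + a ^ 2 * s := by positivity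
  have key : ‖x - a • y‖ ^ 2 / v + 1 / s * ‖y‖ ^ 2 - 1 / (v + a ^ 2 * s) * ‖x‖ ^ 2 =
      ‖(a * s) • x - (v + a ^ 2 * s) • y‖ ^ 2 / (v * (v + a ^ 2 * s) * s) := by
    rw [norm_sub_sq_real, norm_sub_sq_real, norm_smul, norm_smul, norm_smul, inner_smul_right,
      inner_smul_right, inner_smul_left, mul_pow, mul_pow, mul_pow, Real.norm_eq_abs,
      Real.norm_eq_abs, Real.norm_eq_abs, sq_abs, sq_abs, sq_abs]
    simp only [conj_trivial]
    field_simp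
    ring
  have : 0 ≤ ‖(a * s) • x - (v + a ^ 2 * s) • y‖ ^ 2 / (v * (v + a ^ 2 * s) * s) := by
    positivity
  linarith

/-- Strong log-concavity is preserved by Gaussian convolution. -/
theorem IsMidpointLogConcave.gaussian_mollification {s : ℝ} (hs : 0 < s)
    (hlc : IsMidpointLogConcave (1 / s) p) (hpos : ∀ x, 0 < p x) (hpc : Continuous p)
    (hp : Integrable p) (a : ℝ) {v : ℝ} (hv : 0 < v) :
    IsMidpointLogConcave (1 / (v + a ^ 2 * s))
      (fun x => ∫ y, Real.exp (-‖x - a • y‖ ^ 2 / (2 * v)) * p y) := by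
  intro x₁ x₂
  set m := (2⁻¹ : ℝ) • (x₁ + x₂) with hm
  set r := 1 / (v + a ^ 2 * s) / 4 * ‖x₁ - x₂‖ ^ 2 with hr
  let q : EuclideanSpace ℝ (Fin d) → EuclideanSpace ℝ (Fin d) → ℝ := fun x y =>
    Real.exp (-‖x - a • y‖ ^ 2 / (2 * v)) * p y
  have hq0 : ∀ x y, 0 ≤ q x y := fun x y => mul_nonneg (Real.exp_pos _).le (hpos y).le
  have hqm : ∀ x, Measurable fun y => ENNReal.ofReal (q x y) := fun x =>
    (Continuous.measurable (by fun_prop)).ennreal_ofReal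
  have hql : ∀ x, ENNReal.ofReal (∫ y, q x y) = ∫⁻ y, ENNReal.ofReal (q x y) := fun x =>
    ofReal_integral_eq_lintegral_ofReal (integrable_exp_neg_norm_sq_mul hp a hv x)
      (ae_of_all _ (hq0 x))
  -- The Prékopa–Leindler hypothesis in y, with the gain exp(-r) split as a factor exp(-r/2) on the
  -- third function, since that one is squared. The parallelogram law leaves a term in (x₁ - x₂) -
  -- a(y₁ - y₂), which joins the gain of p in y₁ - y₂ to give r.
  have hpt : ∀ y₁ y₂, q x₁ y₁ * q x₂ y₂ ≤
      (Real.exp (-(r / 2)) * q m ((2⁻¹ : ℝ) • (y₁ + y₂))) ^ 2 := by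
    intro y₁ y₂
    set w := (2⁻¹ : ℝ) • (y₁ + y₂) with hw
    have par : ‖x₁ - a • y₁‖ ^ 2 + ‖x₂ - a • y₂‖ ^ 2 =
        2 * ‖m - a • w‖ ^ 2 + ‖(x₁ - x₂) - a • (y₁ - y₂)‖ ^ 2 / 2 := by
      have h := parallelogram_law_with_norm ℝ (x₁ - a • y₁) (x₂ - a • y₂)
      have e1 : x₁ - a • y₁ + (x₂ - a • y₂) = (2 : ℝ) • (m - a • w) := by
        rw [hm, hw]; module
      have e2 : x₁ - a • y₁ - (x₂ - a • y₂) = (x₁ - x₂) - a • (y₁ - y₂) := by module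
      rw [e1, e2, norm_smul] at h
      norm_num at h
      linarith
    have hquad := mul_norm_sq_le_of_inv_add (a := a) hv hs (x₁ - x₂) (y₁ - y₂)
    calc q x₁ y₁ * q x₂ y₂
        = Real.exp (-(‖x₁ - a • y₁‖ ^ 2 + ‖x₂ - a • y₂‖ ^ 2) / (2 * v)) * (p y₁ * p y₂) := by
          rw [neg_add, add_div, Real.exp_add]
          ring
      _ ≤ Real.exp (-(‖x₁ - a • y₁‖ ^ 2 + ‖x₂ - a • y₂‖ ^ 2) / (2 * v)) *
          (p w ^ 2 * Real.exp (-(1 / s / 4 * ‖y₁ - y₂‖ ^ 2))) := by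
          exact mul_le_mul_of_nonneg_left (hlc y₁ y₂) (Real.exp_pos _).le
      _ = Real.exp (-(‖x₁ - a • y₁‖ ^ 2 + ‖x₂ - a • y₂‖ ^ 2) / (2 * v) +
          -(1 / s / 4 * ‖y₁ - y₂‖ ^ 2)) * p w ^ 2 := by
          rw [Real.exp_add]
          ring
      _ ≤ Real.exp (2 * (-(r / 2) + -‖m - a • w‖ ^ 2 / (2 * v))) * p w ^ 2 := by
          gcongr
          rw [par, hr]
          have : -(2 * ‖m - a • w‖ ^ 2 + ‖(x₁ - x₂) - a • (y₁ - y₂)‖ ^ 2 / 2) / (2 * v) =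
              2 * (-‖m - a • w‖ ^ 2 / (2 * v)) -
                ‖(x₁ - x₂) - a • (y₁ - y₂)‖ ^ 2 / v / 4 := by
            field_simp
            ring
          linarith
      _ = _ := by
          rw [two_mul, Real.exp_add, Real.exp_add]
          ring
  have key := lintegral_mul_lintegral_le_sq (hqm x₁) (hqm x₂)
    ((hqm m).const_mul (ENNReal.ofReal (Real.exp (-(r / 2))))) fun y₁ y₂ => by
      rw [← ENNReal.ofReal_mul (hq0 _ _), ← ENNReal.ofReal_mul (Real.exp_pos _).le,
        ← ENNReal.ofReal_pow (mul_nonneg (Real.exp_pos _).le (hq0 _ _))]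
      exact ENNReal.ofReal_le_ofReal (hpt y₁ y₂)
  have hi : ∀ x, 0 ≤ ∫ y, q x y := fun x => integral_nonneg (hq0 x)
  rw [lintegral_const_mul' _ _ (by simp), ← hql, ← hql, ← hql, ← ENNReal.ofReal_mul (hi _),
    ← ENNReal.ofReal_mul (Real.exp_pos _).le,
    ← ENNReal.ofReal_pow (mul_nonneg (Real.exp_pos _).le (hi _)),
    ENNReal.ofReal_le_ofReal_iff (by positivity)] at key
  refine key.trans_eq ?_
  rw [mul_pow, ← Real.exp_nat_mul, mul_comm]
  congr 2
  push_cast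
  ring

theorem IsMidpointLogConcave.const_mul {c K : ℝ} (h : IsMidpointLogConcave c p) :
    IsMidpointLogConcave c fun x => K * p x := by
  intro y z
  calc K * p y * (K * p z) = K ^ 2 * (p y * p z) := by ring
    _ ≤ K ^ 2 * (p ((2⁻¹ : ℝ) • (y + z)) ^ 2 * Real.exp (-(c / 4 * ‖y - z‖ ^ 2))) :=
        mul_le_mul_of_nonneg_left (h y z) (sq_nonneg K)
    _ = _ := by ring

variable {α β : ℝ → ℝ} {t : ℝ}

theorem marginalDensity_const_pos (hβ : β t ≠ 0) :
    0 < ((2 * Real.pi * β t ^ 2) ^ ((d : ℝ) / 2))⁻¹ := by positivity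

theorem marginalDensity_pos (hp : Integrable p) (hpos : ∀ x, 0 < p x) (hβ : β t ≠ 0)
    (x : EuclideanSpace ℝ (Fin d)) : 0 < marginalDensity α β p t x := by
  rw [marginalDensity_eq hβ]
  exact mul_pos (marginalDensity_const_pos hβ)
    (gaussian_mollification_pos hp hpos _ (by positivity) x)

theorem differentiableAt_score (hp : Integrable p) (hpos : ∀ x, 0 < p x) (hβ : β t ≠ 0)
    (x : EuclideanSpace ℝ (Fin d)) : DifferentiableAt ℝ (score α β p t) x := by
  have hv : 0 < β t ^ 2 := by positivity
  have hd : Differentiable ℝ fun x => ∫ y, Real.exp (-‖x - α t • y‖ ^ 2 / (2 * β t ^ 2)) * p y :=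
    fun x => (hasFDerivAt_gaussian_mollification hp (α t) hv x).differentiableAt
  refine differentiableAt_gradient_log (marginalDensity_pos hp hpos hβ) ?_ (fun e => ?_) x
  · rw [marginalDensity_eq hβ]
    exact hd.const_mul _
  · rw [marginalDensity_eq hβ]
    have : (fun z => fderiv ℝ (fun x => ((2 * Real.pi * β t ^ 2) ^ ((d : ℝ) / 2))⁻¹ *
        ∫ y, Real.exp (-‖x - α t • y‖ ^ 2 / (2 * β t ^ 2)) * p y) z e) =
        fun z => ((2 * Real.pi * β t ^ 2) ^ ((d : ℝ) / 2))⁻¹ *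
          fderiv ℝ (fun x => ∫ y, Real.exp (-‖x - α t • y‖ ^ 2 / (2 * β t ^ 2)) * p y) z e := by
      ext z
      rw [fderiv_const_mul (hd z)]
      simp
    rw [this]
    exact (differentiable_fderiv_gaussian_mollification hp (α t) hv e).const_mul _

theorem inner_fderiv_score_le {σ₁ : ℝ} (hσ₁ : 0 < σ₁) (hp : IsPosC2Density p)
    (hlc : IsStronglyLogConcave (1 / σ₁ ^ 2) p) (hβ : β t ≠ 0) (x v : EuclideanSpace ℝ (Fin d)) :
    inner ℝ v (fderiv ℝ (score α β p t) x v) ≤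
      -(1 / (β t ^ 2 + α t ^ 2 * σ₁ ^ 2)) * ‖v‖ ^ 2 := by
  have hv : 0 < β t ^ 2 := by positivity
  have hmid : IsMidpointLogConcave (1 / (β t ^ 2 + α t ^ 2 * σ₁ ^ 2))
      (marginalDensity α β p t) := by
    rw [marginalDensity_eq hβ]
    exact ((hlc.isMidpointLogConcave hp).gaussian_mollification (by positivity) hp.pos
      hp.contDiff.continuous hp.integrable (α t) hv).const_mul
  refine hmid.inner_fderiv_gradient_log_le (marginalDensity_pos hp.integrable hp.pos hβ) ?_
    (differentiableAt_score hp.integrable hp.pos hβ x) v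
  rw [marginalDensity_eq hβ]
  exact fun x =>
    (hasFDerivAt_gaussian_mollification hp.integrable (α t) hv x).differentiableAt.const_mul _

/-- Complete the square in y; translation invariance then removes the centre (a s/(v + a² s)) x. -/
theorem gaussian_mollification_gaussian {E : Type*} [NormedAddCommGroup E]
    [InnerProductSpace ℝ E] [MeasurableSpace E] [BorelSpace E] (μ : Measure E)
    [μ.IsAddRightInvariant] {v s : ℝ} (hv : 0 < v) (hs : 0 < s) (a : ℝ) (x : E) :
    ∫ y, Real.exp (-‖x - a • y‖ ^ 2 / (2 * v)) * Real.exp (-‖y‖ ^ 2 / (2 * s)) ∂μ =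
      Real.exp (-‖x‖ ^ 2 / (2 * (v + a ^ 2 * s))) *
        ∫ y, Real.exp (-‖y‖ ^ 2 * ((v + a ^ 2 * s) / (2 * v * s))) ∂μ := by
  have hS : 0 < v + a ^ 2 * s := by positivity
  rw [← integral_sub_right_eq_self
    (fun y => Real.exp (-‖y‖ ^ 2 * ((v + a ^ 2 * s) / (2 * v * s))))
    ((a * s / (v + a ^ 2 * s)) • x), ← integral_const_mul]
  refine integral_congr_ae (ae_of_all _ fun y => ?_)
  simp only [← Real.exp_add]
  congr 1
  rw [norm_sub_sq_real, norm_sub_sq_real, norm_smul, norm_smul, inner_smul_right,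
    inner_smul_right, mul_pow, mul_pow, Real.norm_eq_abs, Real.norm_eq_abs, sq_abs, sq_abs,
    real_inner_comm x y]
  field_simp
  ring

theorem score_isoGaussianDensity {σ₁ : ℝ} (hσ₁ : 0 < σ₁) (hβ : β t ≠ 0)
    (hp : Integrable (isoGaussianDensity (0 : EuclideanSpace ℝ (Fin d)) (σ₁ ^ 2)))
    (x : EuclideanSpace ℝ (Fin d)) :
    score α β (isoGaussianDensity 0 (σ₁ ^ 2)) t x =
      (-(1 / (β t ^ 2 + α t ^ 2 * σ₁ ^ 2))) • x := by
  have hv : 0 < β t ^ 2 := by positivity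
  set S := β t ^ 2 + α t ^ 2 * σ₁ ^ 2 with hS
  have hS0 : 0 < S := by positivity
  obtain ⟨K, hK⟩ : ∃ K, marginalDensity α β (isoGaussianDensity
      (0 : EuclideanSpace ℝ (Fin d)) (σ₁ ^ 2)) t = fun x => Real.exp (-‖x‖ ^ 2 / (2 * S)) * K := by
    -- The value of K is irrelevant: log K has zero gradient. Only K > 0 is needed, to split the
    -- logarithm.
    refine ⟨((2 * Real.pi * β t ^ 2) ^ ((d : ℝ) / 2))⁻¹ *
      (((2 * Real.pi * σ₁ ^ 2) ^ ((d : ℝ) / 2))⁻¹ *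
      ∫ y : EuclideanSpace ℝ (Fin d), Real.exp (-‖y‖ ^ 2 * (S / (2 * β t ^ 2 * σ₁ ^ 2)))), ?_⟩
    rw [marginalDensity_eq hβ]
    ext x
    have : ∀ y, Real.exp (-‖x - α t • y‖ ^ 2 / (2 * β t ^ 2)) *
        isoGaussianDensity (0 : EuclideanSpace ℝ (Fin d)) (σ₁ ^ 2) y =
        ((2 * Real.pi * σ₁ ^ 2) ^ ((d : ℝ) / 2))⁻¹ *
          (Real.exp (-‖x - α t • y‖ ^ 2 / (2 * β t ^ 2)) *
            Real.exp (-‖y‖ ^ 2 / (2 * σ₁ ^ 2))) := by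
      intro y
      rw [isoGaussianDensity, sub_zero]
      ring
    simp only [this]
    rw [integral_const_mul, gaussian_mollification_gaussian volume hv (by positivity)]
    ring
  have hK0 : 0 < K := by
    have := marginalDensity_pos (α := α) hp (isoGaussianDensity_pos 0 (by positivity)) hβ 0
    rw [hK] at this
    simpa using this
  have hlog : (fun z => Real.log (marginalDensity α β (isoGaussianDensity
      (0 : EuclideanSpace ℝ (Fin d)) (σ₁ ^ 2)) t z)) =
      fun z => -(1 / (2 * S)) * ‖z‖ ^ 2 + Real.log K := by
    ext z
    rw [hK, Real.log_mul (Real.exp_pos _).ne' hK0.ne', Real.log_exp]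
    ring
  rw [score, hlog]
  refine HasGradientAt.gradient ?_
  rw [hasGradientAt_iff_hasFDerivAt]
  refine (((hasStrictFDerivAt_norm_sq x).hasFDerivAt.const_mul (-(1 / (2 * S)))).add_const
    (Real.log K)).congr_fderiv ?_
  ext w
  simp only [smul_apply, innerSL_apply_apply, smul_eq_mul, nsmul_eq_mul, Nat.cast_ofNat,
    InnerProductSpace.toDual_apply_apply, inner_smul_left, conj_trivial]
  field_simp

end Marginal

/-! ### The integral of χ in closed form. -/

namespace IsSchedule

variable {α β : ℝ → ℝ} {σ₁ t : ℝ}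

theorem alpha_pos_Ioc (h : IsSchedule α β) (ht : t ∈ Ioc (0 : ℝ) 1) : 0 < α t := by
  rcases ht.2.eq_or_lt with rfl | h1
  · rw [h.alpha_one]; exact one_pos
  · exact h.alpha_pos t ⟨ht.1, h1⟩

theorem variance_pos (h : IsSchedule α β) (hσ₁ : 0 < σ₁) (ht : t ∈ Ioc (0 : ℝ) 1) :
    0 < β t ^ 2 + α t ^ 2 * σ₁ ^ 2 := by
  have := h.alpha_pos_Ioc ht
  positivity

theorem continuousOn_log_alpha (h : IsSchedule α β) :
    ContinuousOn (fun t => Real.log (α t)) (Ioc 0 1) :=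
  (h.alpha_cont.mono Ioc_subset_Icc_self).log fun _ ht => (h.alpha_pos_Ioc ht).ne'

theorem continuousOn_log_variance (h : IsSchedule α β) (hσ₁ : 0 < σ₁) :
    ContinuousOn (fun t => Real.log (β t ^ 2 + α t ^ 2 * σ₁ ^ 2)) (Ioc 0 1) :=
  (((h.beta_cont.pow 2).add ((h.alpha_cont.pow 2).mul continuousOn_const)).mono
    Ioc_subset_Icc_self).log fun _ ht => (h.variance_pos hσ₁ ht).ne'

theorem hasDerivAt_log_alpha (h : IsSchedule α β) (ht : t ∈ Ioo (0 : ℝ) 1) :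
    HasDerivAt (fun t => Real.log (α t)) (kappa α t) t :=
  (h.alpha_diff t ht).hasDerivAt.log (h.alpha_pos t ht).ne'

theorem hasDerivAt_log_variance (h : IsSchedule α β) (hσ₁ : 0 < σ₁) (ht : t ∈ Ioo (0 : ℝ) 1) :
    HasDerivAt (fun t => Real.log (β t ^ 2 + α t ^ 2 * σ₁ ^ 2))
      (2 * kappa α t - 2 * eta α β t / (β t ^ 2 + α t ^ 2 * σ₁ ^ 2)) t := by
  have hS := h.variance_pos hσ₁ (Ioo_subset_Ioc_self ht)
  have hα := h.alpha_pos t ht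
  refine ((((h.beta_diff t ht).hasDerivAt.pow 2).add
    (((h.alpha_diff t ht).hasDerivAt.pow 2).mul_const (σ₁ ^ 2))).log hS.ne').congr_deriv ?_
  simp only [Pi.add_apply, Pi.pow_apply, kappa, eta]
  field_simp
  ring

/-- The subtracted term 2η/(β² + α²σ₁²) is nonnegative and is the derivative of 2 log α - log(β² +
α²σ₁²), which is continuous up to 1. Hence it is integrable even if α̇ and β̇ are singular at 1. -/
theorem intervalIntegrable_chi (h : IsSchedule α β) (hσ₁ : 0 < σ₁) (ht : t ∈ Ioc (0 : ℝ) 1) :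
    IntervalIntegrable (chi α β σ₁) volume t 1 := by
  refine (h.kappa_int t ht).sub ?_
  refine intervalIntegral.intervalIntegrable_deriv_of_nonneg
    (g := fun t => 2 * Real.log (α t) - Real.log (β t ^ 2 + α t ^ 2 * σ₁ ^ 2)) ?_ ?_ ?_
  · rw [uIcc_of_le ht.2]
    exact ((continuousOn_const.mul h.continuousOn_log_alpha).sub
      (h.continuousOn_log_variance hσ₁)).mono fun s hs => ⟨ht.1.trans_le hs.1, hs.2⟩
  · rw [min_eq_left ht.2, max_eq_right ht.2]
    intro s hs
    have hs' : s ∈ Ioo (0 : ℝ) 1 := ⟨ht.1.trans hs.1, hs.2⟩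
    refine (((h.hasDerivAt_log_alpha hs').const_mul 2).sub
      (h.hasDerivAt_log_variance hσ₁ hs')).congr_deriv ?_
    ring
  · rw [min_eq_left ht.2, max_eq_right ht.2]
    intro s hs
    have hs' : s ∈ Ioo (0 : ℝ) 1 := ⟨ht.1.trans hs.1, hs.2⟩
    exact div_nonneg (mul_nonneg zero_le_two (h.eta_nonneg s hs'))
      (h.variance_pos hσ₁ (Ioo_subset_Ioc_self hs')).le

theorem exp_integral_chi (h : IsSchedule α β) (hσ₁ : 0 < σ₁) (ht : t ∈ Ioc (0 : ℝ) 1) :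
    Real.exp (∫ s in t..1, chi α β σ₁ s) = σ₁ ^ 2 * α t / (β t ^ 2 + α t ^ 2 * σ₁ ^ 2) := by
  have hS := h.variance_pos hσ₁ ht
  have hα := h.alpha_pos_Ioc ht
  rw [intervalIntegral.integral_eq_sub_of_hasDerivAt_of_le ht.2
    (f := fun t => Real.log (β t ^ 2 + α t ^ 2 * σ₁ ^ 2) - Real.log (α t))
    (((h.continuousOn_log_variance hσ₁).sub h.continuousOn_log_alpha).mono
      fun s hs => ⟨ht.1.trans_le hs.1, hs.2⟩) (fun s hs => ?_) (h.intervalIntegrable_chi hσ₁ ht)]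
  · rw [h.alpha_one, h.beta_one, Real.log_one]
    have : (0 : ℝ) ^ 2 + 1 ^ 2 * σ₁ ^ 2 = σ₁ ^ 2 := by ring
    rw [this, sub_zero, Real.exp_sub, Real.exp_sub, Real.exp_log (by positivity),
      Real.exp_log hS, Real.exp_log hα]
    field_simp
  · have hs' : s ∈ Ioo (0 : ℝ) 1 := ⟨ht.1.trans hs.1, hs.2⟩
    refine ((h.hasDerivAt_log_variance hσ₁ hs').sub (h.hasDerivAt_log_alpha hs')).congr_deriv ?_
    rw [chi]
    ring

theorem hasDerivAt_ratio (h : IsSchedule α β) (hσ₁ : 0 < σ₁) (ht : t ∈ Ioo (0 : ℝ) 1) :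
    HasDerivAt (fun t => (β t ^ 2 + α t ^ 2 * σ₁ ^ 2) / α t)
      ((β t ^ 2 + α t ^ 2 * σ₁ ^ 2) / α t * chi α β σ₁ t) t := by
  have hS := h.variance_pos hσ₁ (Ioo_subset_Ioc_self ht)
  have hα := h.alpha_pos t ht
  refine ((((h.beta_diff t ht).hasDerivAt.pow 2).add
    (((h.alpha_diff t ht).hasDerivAt.pow 2).mul_const (σ₁ ^ 2))).div
      (h.alpha_diff t ht).hasDerivAt hα.ne').congr_deriv ?_
  simp only [Pi.add_apply, Pi.pow_apply, kappa, eta, chi]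
  field_simp
  ring

end IsSchedule

/-! ### The drift Jacobian and the monotone quantity. -/

section Adjoint

variable {d : ℕ} {p r : EuclideanSpace ℝ (Fin d) → ℝ} {α β : ℝ → ℝ} {σ₁ t : ℝ}

theorem eta_eq_zero (hβ : β t = 0) : eta α β t = 0 := by simp [eta, hβ]

theorem chi_eq_kappa (hβ : β t = 0) : chi α β σ₁ t = kappa α t := by simp [chi, eta_eq_zero hβ]

theorem baseDrift_memorylessNoise (hη : 0 ≤ eta α β t) :
    baseDrift α β (memorylessNoise α β) p t =
      fun x => kappa α t • x + (2 * eta α β t) • score α β p t x := by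
  ext1 x
  rw [baseDrift, memorylessNoise, Real.sq_sqrt (by positivity)]
  congr 2
  ring

theorem baseDrift_memorylessNoise_of_beta_eq_zero (hβ : β t = 0) :
    baseDrift α β (memorylessNoise α β) p t = fun x => kappa α t • x := by
  rw [baseDrift_memorylessNoise (eta_eq_zero hβ).ge]
  simp [eta_eq_zero hβ]

theorem fderiv_smul_id (c : ℝ) (x v : EuclideanSpace ℝ (Fin d)) :
    fderiv ℝ (fun x : EuclideanSpace ℝ (Fin d) => c • x) x v = c • v := by
  have h : HasFDerivAt (fun x : EuclideanSpace ℝ (Fin d) => c • x)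
      (c • ContinuousLinearMap.id ℝ (EuclideanSpace ℝ (Fin d))) x := (hasFDerivAt_id x).const_smul c
  rw [h.fderiv]
  simp

theorem inner_fderiv_baseDrift_le (hσ₁ : 0 < σ₁) (hp : IsPosC2Density p)
    (hlc : IsStronglyLogConcave (1 / σ₁ ^ 2) p) (hη : 0 ≤ eta α β t)
    (x v : EuclideanSpace ℝ (Fin d)) :
    inner ℝ v (fderiv ℝ (baseDrift α β (memorylessNoise α β) p t) x v) ≤
      chi α β σ₁ t * ‖v‖ ^ 2 := by
  -- β may vanish inside (0, 1); there the drift is linear and differentiability of the score is not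
  -- needed.
  by_cases hβ : β t = 0
  · rw [baseDrift_memorylessNoise_of_beta_eq_zero hβ, fderiv_smul_id, inner_smul_right,
      real_inner_self_eq_norm_sq, chi_eq_kappa hβ]
  · rw [baseDrift_memorylessNoise hη]
    have hs := differentiableAt_score (α := α) hp.integrable hp.pos hβ x
    have hs' : DifferentiableAt ℝ (fun x => (2 * eta α β t) • score α β p t x) x :=
      hs.fun_const_smul _
    have hk : DifferentiableAt ℝ (fun x : EuclideanSpace ℝ (Fin d) => kappa α t • x) x :=
      differentiableAt_id.fun_const_smul _
    rw [fderiv_fun_add hk hs', add_apply, fderiv_smul_id, fderiv_fun_const_smul hs, smul_apply, inner_add_right,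
      inner_smul_right, inner_smul_right, real_inner_self_eq_norm_sq]
    have h1 := mul_le_mul_of_nonneg_left (inner_fderiv_score_le (α := α) hσ₁ hp hlc hβ x v)
      (mul_nonneg zero_le_two hη)
    have h2 : chi α β σ₁ t * ‖v‖ ^ 2 = kappa α t * ‖v‖ ^ 2 +
        2 * eta α β t * (-(1 / (β t ^ 2 + α t ^ 2 * σ₁ ^ 2)) * ‖v‖ ^ 2) := by
      rw [chi]; ring
    linarith

theorem fderiv_baseDrift_isoGaussianDensity (hσ₁ : 0 < σ₁)
    (hp : IsPosC2Density (isoGaussianDensity (0 : EuclideanSpace ℝ (Fin d)) (σ₁ ^ 2)))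
    (hη : 0 ≤ eta α β t) (x v : EuclideanSpace ℝ (Fin d)) :
    fderiv ℝ (baseDrift α β (memorylessNoise α β) (isoGaussianDensity 0 (σ₁ ^ 2)) t) x v =
      chi α β σ₁ t • v := by
  by_cases hβ : β t = 0
  · rw [baseDrift_memorylessNoise_of_beta_eq_zero hβ, fderiv_smul_id, chi_eq_kappa hβ]
  · have : baseDrift α β (memorylessNoise α β)
        (isoGaussianDensity (0 : EuclideanSpace ℝ (Fin d)) (σ₁ ^ 2)) t =
        fun x => chi α β σ₁ t • x := by
      rw [baseDrift_memorylessNoise hη]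
      ext1 x
      rw [score_isoGaussianDensity hσ₁ hβ hp.integrable, smul_smul, ← add_smul, chi]
      congr 1
      ring
    rw [this, fderiv_smul_id]

namespace IsLeanAdjoint

variable {X a : ℝ → EuclideanSpace ℝ (Fin d)}

/-- The weight R = (β² + α²σ₁²)/α solves Ṙ = χR. The trajectory enters only as the point where the
Jacobian is evaluated, so no regularity of X is involved. -/
theorem hasDerivAt_norm_sq (ha : IsLeanAdjoint α β (memorylessNoise α β) p r X a)
    (hs : IsSchedule α β) (hσ₁ : 0 < σ₁) (ht : t ∈ Ioo (0 : ℝ) 1) :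
    HasDerivAt (fun t => ‖a t‖ ^ 2 * ((β t ^ 2 + α t ^ 2 * σ₁ ^ 2) / α t) ^ 2)
      (2 * ((β t ^ 2 + α t ^ 2 * σ₁ ^ 2) / α t) ^ 2 * (chi α β σ₁ t * ‖a t‖ ^ 2 -
        inner ℝ (a t) (fderiv ℝ (baseDrift α β (memorylessNoise α β) p t) (X t) (a t)))) t := by
  refine ((ha.ode t ht).norm_sq.mul ((hs.hasDerivAt_ratio hσ₁ ht).pow 2)).congr_deriv ?_
  rw [inner_neg_right, ContinuousLinearMap.adjoint_inner_right, real_inner_comm]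
  simp only [Pi.pow_apply, Nat.cast_ofNat]
  ring

theorem continuousOn_norm_sq (ha : IsLeanAdjoint α β (memorylessNoise α β) p r X a)
    (hs : IsSchedule α β) :
    ContinuousOn (fun t => ‖a t‖ ^ 2 * ((β t ^ 2 + α t ^ 2 * σ₁ ^ 2) / α t) ^ 2) (Ioc 0 1) := by
  have hα := hs.alpha_cont.mono Ioc_subset_Icc_self
  have hβ := hs.beta_cont.mono Ioc_subset_Icc_self
  exact (ha.cont.norm.pow 2).mul ((((hβ.pow 2).add ((hα.pow 2).mul continuousOn_const)).div hα
    fun t ht => (hs.alpha_pos_Ioc ht).ne').pow 2)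

/-- As R(1) = σ₁² and exp(∫_t^1 χ) = σ₁²/R(t), comparing ‖a‖²R² at t and 1 is the norm bound after a
square root. Both directions are kept for the equality case. -/
theorem norm_le_iff (ha : IsLeanAdjoint α β (memorylessNoise α β) p r X a)
    (hs : IsSchedule α β) (hσ₁ : 0 < σ₁) (ht : t ∈ Ioc (0 : ℝ) 1) :
    (‖a t‖ ^ 2 * ((β t ^ 2 + α t ^ 2 * σ₁ ^ 2) / α t) ^ 2 ≤
        ‖a 1‖ ^ 2 * ((β 1 ^ 2 + α 1 ^ 2 * σ₁ ^ 2) / α 1) ^ 2 ↔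
      ‖a t‖ ≤ Real.exp (∫ s in t..1, chi α β σ₁ s) * ‖gradient r (X 1)‖) ∧
    (‖a 1‖ ^ 2 * ((β 1 ^ 2 + α 1 ^ 2 * σ₁ ^ 2) / α 1) ^ 2 ≤
        ‖a t‖ ^ 2 * ((β t ^ 2 + α t ^ 2 * σ₁ ^ 2) / α t) ^ 2 ↔
      Real.exp (∫ s in t..1, chi α β σ₁ s) * ‖gradient r (X 1)‖ ≤ ‖a t‖) := by
  have hS := hs.variance_pos hσ₁ ht
  have hα := hs.alpha_pos_Ioc ht
  have e1 : (β 1 ^ 2 + α 1 ^ 2 * σ₁ ^ 2) / α 1 = σ₁ ^ 2 := by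
    rw [hs.alpha_one, hs.beta_one]; ring
  have e2 : σ₁ ^ 2 * α t / (β t ^ 2 + α t ^ 2 * σ₁ ^ 2) * ‖gradient r (X 1)‖ =
      (‖a 1‖ * σ₁ ^ 2) / ((β t ^ 2 + α t ^ 2 * σ₁ ^ 2) / α t) := by
    rw [ha.terminal, norm_neg]
    field_simp
  have hR : 0 < (β t ^ 2 + α t ^ 2 * σ₁ ^ 2) / α t := div_pos hS hα
  rw [hs.exp_integral_chi hσ₁ ht, e1, e2]
  set R := (β t ^ 2 + α t ^ 2 * σ₁ ^ 2) / α t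
  rw [← mul_pow, ← mul_pow,
    pow_le_pow_iff_left₀ (by positivity) (by positivity) two_ne_zero,
    pow_le_pow_iff_left₀ (by positivity) (by positivity) two_ne_zero, le_div_iff₀ hR,
    div_le_iff₀ hR]
  exact ⟨Iff.rfl, Iff.rfl⟩

theorem norm_le (ha : IsLeanAdjoint α β (memorylessNoise α β) p r X a) (hs : IsSchedule α β)
    (hσ₁ : 0 < σ₁)
    (h : ∀ t ∈ Ioo (0 : ℝ) 1, ∀ x v,
      inner ℝ v (fderiv ℝ (baseDrift α β (memorylessNoise α β) p t) x v) ≤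
        chi α β σ₁ t * ‖v‖ ^ 2)
    (ht : t ∈ Ioc (0 : ℝ) 1) :
    ‖a t‖ ≤ Real.exp (∫ s in t..1, chi α β σ₁ s) * ‖gradient r (X 1)‖ := by
  rw [← (ha.norm_le_iff hs hσ₁ ht).1]
  refine monotoneOn_of_deriv_nonneg (convex_Ioc 0 1) (ha.continuousOn_norm_sq hs)
    ?_ ?_ ht (right_mem_Ioc.2 one_pos) ht.2 <;> rw [interior_Ioc]
  · exact fun s hs' =>
      (ha.hasDerivAt_norm_sq hs hσ₁ hs').differentiableAt.differentiableWithinAt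
  · intro s hs'
    rw [(ha.hasDerivAt_norm_sq hs hσ₁ hs').deriv]
    exact mul_nonneg (by positivity) (sub_nonneg.2 (h s hs' _ _))

theorem norm_eq (ha : IsLeanAdjoint α β (memorylessNoise α β) p r X a) (hs : IsSchedule α β)
    (hσ₁ : 0 < σ₁)
    (h : ∀ t ∈ Ioo (0 : ℝ) 1, ∀ x v,
      inner ℝ v (fderiv ℝ (baseDrift α β (memorylessNoise α β) p t) x v) =
        chi α β σ₁ t * ‖v‖ ^ 2)
    (ht : t ∈ Ioc (0 : ℝ) 1) :
    ‖a t‖ = Real.exp (∫ s in t..1, chi α β σ₁ s) * ‖gradient r (X 1)‖ := by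
  refine le_antisymm (ha.norm_le hs hσ₁ (fun t ht x v => (h t ht x v).le) ht) ?_
  rw [← (ha.norm_le_iff hs hσ₁ ht).2]
  refine antitoneOn_of_deriv_nonpos (convex_Ioc 0 1) (ha.continuousOn_norm_sq hs)
    ?_ ?_ ht (right_mem_Ioc.2 one_pos) ht.2 <;> rw [interior_Ioc]
  · exact fun s hs' =>
      (ha.hasDerivAt_norm_sq hs hσ₁ hs').differentiableAt.differentiableWithinAt
  · intro s hs'
    rw [(ha.hasDerivAt_norm_sq hs hσ₁ hs').deriv, h s hs', sub_self, mul_zero]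

end IsLeanAdjoint

theorem tendsto_norm_nhdsGT_zero {E : Type*} [NormedAddCommGroup E] {a : ℝ → E}
    (h : ContinuousWithinAt a (Icc 0 1) 0) : Tendsto (fun t => ‖a t‖) (𝓝[>] 0) (𝓝 ‖a 0‖) := by
  rw [← nhdsWithin_Ioc_eq_nhdsGT (one_pos : (0 : ℝ) < 1)]
  exact (h.mono Ioc_subset_Icc_self).norm

theorem eventually_mem_Ioc : ∀ᶠ t : ℝ in 𝓝[>] 0, t ∈ Ioc (0 : ℝ) 1 := by
  rw [← nhdsWithin_Ioc_eq_nhdsGT (one_pos : (0 : ℝ) < 1)]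
  exact self_mem_nhdsWithin

end Adjoint

/-! ### Föllmer, DDPM/DDIM and rectified flow schedules. -/

section Examples

variable {A : ℝ → ℝ} {σ₀ σ₁ t : ℝ}

theorem intervalIntegrable_kappa {α : ℝ → ℝ} (hc : ContinuousOn α (Icc 0 1))
    (hd : ∀ t ∈ Ioo (0 : ℝ) 1, DifferentiableAt ℝ α t) (hpos : ∀ t ∈ Ioc (0 : ℝ) 1, 0 < α t)
    (hκ : ∀ t ∈ Ioo (0 : ℝ) 1, 0 ≤ kappa α t) (ht : t ∈ Ioc (0 : ℝ) 1) :
    IntervalIntegrable (kappa α) volume t 1 := by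
  refine intervalIntegral.intervalIntegrable_deriv_of_nonneg (g := fun t => Real.log (α t))
    ?_ ?_ ?_
  · rw [uIcc_of_le ht.2]
    exact (hc.mono (Icc_subset_Icc_left ht.1.le)).log
      fun s hs => (hpos s ⟨ht.1.trans_le hs.1, hs.2⟩).ne'
  · rw [min_eq_left ht.2, max_eq_right ht.2]
    exact fun s hs => (hd s ⟨ht.1.trans hs.1, hs.2⟩).hasDerivAt.log
      (hpos s ⟨ht.1.trans hs.1, hs.2.le⟩).ne'
  · rw [min_eq_left ht.2, max_eq_right ht.2]
    exact fun s hs => hκ s ⟨ht.1.trans hs.1, hs.2⟩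

/-- The explicit factor, extended to `t = 0` by continuity. -/
theorem IsSchedule.expIntegralEq {α β f : ℝ → ℝ} (h : IsSchedule α β) (hσ₁ : 0 < σ₁)
    (hf : ∀ t ∈ Ioc (0 : ℝ) 1, σ₁ ^ 2 * α t / (β t ^ 2 + α t ^ 2 * σ₁ ^ 2) = f t)
    (hc : ContinuousWithinAt f (Icc 0 1) 0) : ExpIntegralEq (chi α β σ₁) f := by
  have key : ∀ t ∈ Ioc (0 : ℝ) 1, Real.exp (∫ s in t..1, chi α β σ₁ s) = f t := fun t ht =>
    (h.exp_integral_chi hσ₁ ht).trans (hf t ht)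
  refine ⟨fun t ht => ⟨h.intervalIntegrable_chi hσ₁ ht, key t ht⟩, ?_⟩
  have : Tendsto f (𝓝[>] 0) (𝓝 (f 0)) := by
    rw [← nhdsWithin_Ioc_eq_nhdsGT (one_pos : (0 : ℝ) < 1)]
    exact hc.mono Ioc_subset_Icc_self
  refine this.congr' ?_
  filter_upwards [eventually_mem_Ioc] with t ht using (key t ht).symm

namespace IsAlphaBar

theorem pos (h : IsAlphaBar A) (ht : t ∈ Ioc (0 : ℝ) 1) : 0 < A t := by
  rcases ht.2.eq_or_lt with rfl | h1
  · rw [h.one]; exact one_pos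
  · exact (h.mem t ⟨ht.1, h1⟩).1

theorem le_one (h : IsAlphaBar A) (ht : t ∈ Ioc (0 : ℝ) 1) : A t ≤ 1 := by
  rw [← h.one]
  exact h.mono (Ioc_subset_Icc_self ht) (right_mem_Icc.2 zero_le_one) ht.2

/-- In all three schedules κ and η are nonnegative multiples of the derivative of ᾱ, so this sign
gives both integrability of κ and η ≥ 0. -/
theorem deriv_nonneg (h : IsAlphaBar A) (ht : t ∈ Ioo (0 : ℝ) 1) : 0 ≤ deriv A t := by
  have hn : Ioo (0 : ℝ) 1 ∈ 𝓝 t := Ioo_mem_nhds ht.1 ht.2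
  rw [← derivWithin_of_mem_nhds hn]
  exact (h.mono.mono Ioo_subset_Icc_self).derivWithin_nonneg

theorem continuousWithinAt_zero (h : IsAlphaBar A) : ContinuousWithinAt A (Icc 0 1) 0 :=
  h.cont 0 (left_mem_Icc.2 zero_le_one)

theorem isSchedule_follmer (h : IsAlphaBar A) :
    IsSchedule (follmerAlpha A) (follmerBeta A σ₀) where
  alpha_zero := h.zero
  alpha_one := h.one
  beta_one := by simp [follmerBeta, h.one]
  alpha_cont := h.cont
  beta_cont := (h.cont.mul (continuousOn_const.sub h.cont)).sqrt.mul continuousOn_const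
  alpha_diff := h.diff
  beta_diff t ht := by
    have hA := h.mem t ht
    exact (((h.diff t ht).mul ((differentiableAt_const 1).sub (h.diff t ht))).sqrt
      (mul_pos hA.1 (sub_pos.2 hA.2)).ne').mul_const σ₀
  alpha_pos t ht := (h.mem t ht).1
  kappa_int t ht := intervalIntegrable_kappa h.cont h.diff (fun _ => h.pos)
    (fun t ht => div_nonneg (h.deriv_nonneg ht) (h.mem t ht).1.le) ht
  eta_nonneg t ht := by
    obtain ⟨h0, h1⟩ := h.mem t ht
    have hq : 0 < A t * (1 - A t) := mul_pos h0 (sub_pos.2 h1)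
    have hd := (h.diff t ht).hasDerivAt
    have hβ : HasDerivAt (follmerBeta A σ₀) _ t :=
      ((hd.mul (hd.const_sub 1)).sqrt hq.ne').mul_const σ₀
    have hsq := Real.sq_sqrt hq.le
    have hs := Real.sqrt_pos.2 hq
    have : eta (follmerAlpha A) (follmerBeta A σ₀) t = σ₀ ^ 2 * deriv A t / 2 := by
      rw [eta, hβ.deriv, kappa]
      change √(A t * (1 - A t)) * σ₀ * (deriv A t / A t * (√(A t * (1 - A t)) * σ₀) - _) = _
      simp only [Pi.mul_apply]
      set q := √(A t * (1 - A t))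
      field_simp
      rw [hsq]
      ring
    rw [this]
    have := h.deriv_nonneg ht
    positivity

theorem isSchedule_ddpm (h : IsAlphaBar A) :
    IsSchedule (ddpmAlpha A) (ddpmBeta A σ₀) where
  alpha_zero := by simp [ddpmAlpha, h.zero]
  alpha_one := by simp [ddpmAlpha, h.one]
  beta_one := by simp [ddpmBeta, h.one]
  alpha_cont := h.cont.sqrt
  beta_cont := (continuousOn_const.sub h.cont).sqrt.mul continuousOn_const
  alpha_diff t ht := (h.diff t ht).sqrt (h.mem t ht).1.ne'
  beta_diff t ht := (((differentiableAt_const 1).sub (h.diff t ht)).sqrt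
    (sub_pos.2 (h.mem t ht).2).ne').mul_const σ₀
  alpha_pos t ht := Real.sqrt_pos.2 (h.mem t ht).1
  kappa_int t ht := by
    refine intervalIntegrable_kappa h.cont.sqrt
      (fun t ht => (h.diff t ht).sqrt (h.mem t ht).1.ne') (fun t ht => Real.sqrt_pos.2 (h.pos ht))
      (fun t ht => ?_) ht
    have hα : HasDerivAt (ddpmAlpha A) _ t := (h.diff t ht).hasDerivAt.sqrt (h.mem t ht).1.ne'
    have := h.deriv_nonneg ht
    change 0 ≤ deriv (ddpmAlpha A) t / √(A t)
    rw [hα.deriv]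
    positivity
  eta_nonneg t ht := by
    obtain ⟨h0, h1⟩ := h.mem t ht
    have hq : 0 < 1 - A t := sub_pos.2 h1
    have hd := (h.diff t ht).hasDerivAt
    have hα : HasDerivAt (ddpmAlpha A) _ t := hd.sqrt h0.ne'
    have hβ : HasDerivAt (ddpmBeta A σ₀) _ t := ((hd.const_sub 1).sqrt hq.ne').mul_const σ₀
    have hs := Real.sqrt_pos.2 hq
    have hs' := Real.sqrt_pos.2 h0
    have hsq := Real.sq_sqrt hq.le
    have hsq' := Real.sq_sqrt h0.le
    have : eta (ddpmAlpha A) (ddpmBeta A σ₀) t = σ₀ ^ 2 * deriv A t / (2 * A t) := by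
      rw [eta, hβ.deriv, kappa, hα.deriv]
      change √(1 - A t) * σ₀ * (deriv A t / (2 * √(A t)) / √(A t) * (√(1 - A t) * σ₀) - _) = _
      set q := √(1 - A t)
      set w := √(A t)
      -- Writing ᾱ as w² makes the identity rational in q and w.
      rw [← hsq'] at hsq ⊢
      field_simp
      rw [hsq]
      ring
    rw [this]
    have := h.deriv_nonneg ht
    positivity

theorem isSchedule_rectified (h : IsAlphaBar A) :
    IsSchedule (rectifiedAlpha A) (rectifiedBeta A σ₀) where
  alpha_zero := h.zero
  alpha_one := h.one
  beta_one := by simp [rectifiedBeta, h.one]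
  alpha_cont := h.cont
  beta_cont := (continuousOn_const.sub h.cont).mul continuousOn_const
  alpha_diff := h.diff
  beta_diff t ht := ((differentiableAt_const 1).sub (h.diff t ht)).mul_const σ₀
  alpha_pos t ht := (h.mem t ht).1
  kappa_int t ht := intervalIntegrable_kappa h.cont h.diff (fun _ => h.pos)
    (fun t ht => div_nonneg (h.deriv_nonneg ht) (h.mem t ht).1.le) ht
  eta_nonneg t ht := by
    obtain ⟨h0, h1⟩ := h.mem t ht
    have hq : 0 < 1 - A t := sub_pos.2 h1
    have hβ : HasDerivAt (rectifiedBeta A σ₀) _ t :=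
      ((h.diff t ht).hasDerivAt.const_sub 1).mul_const σ₀
    have : eta (rectifiedAlpha A) (rectifiedBeta A σ₀) t =
        σ₀ ^ 2 * deriv A t * (1 - A t) / A t := by
      rw [eta, hβ.deriv, kappa]
      change (1 - A t) * σ₀ * (deriv A t / A t * ((1 - A t) * σ₀) - _) = _
      field_simp
      ring
    rw [this]
    have := h.deriv_nonneg ht
    positivity

theorem expIntegralEq_follmer (h : IsAlphaBar A) (hσ₀ : 0 < σ₀) (hσ₁ : 0 < σ₁) :
    ExpIntegralEq (chi (follmerAlpha A) (follmerBeta A σ₀) σ₁)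
      (fun t => σ₁ ^ 2 / ((1 - A t) * σ₀ ^ 2 + A t * σ₁ ^ 2)) := by
  refine h.isSchedule_follmer.expIntegralEq hσ₁ (fun t ht => ?_) ?_
  · have h0 := h.pos ht
    have h1 := sub_nonneg.2 (h.le_one ht)
    have : 0 < (1 - A t) * σ₀ ^ 2 + A t * σ₁ ^ 2 := by positivity
    rw [follmerAlpha, follmerBeta, mul_pow, Real.sq_sqrt (mul_nonneg h0.le h1)]
    -- The common factor ᾱ cancels against α; hence the Föllmer factor does not vanish at t = 0.
    have e : A t * (1 - A t) * σ₀ ^ 2 + A t ^ 2 * σ₁ ^ 2 =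
        A t * ((1 - A t) * σ₀ ^ 2 + A t * σ₁ ^ 2) := by ring
    rw [e]
    field_simp
  · have hA := h.continuousWithinAt_zero
    refine continuousWithinAt_const.div (((continuousWithinAt_const.sub hA).mul
      continuousWithinAt_const).add (hA.mul continuousWithinAt_const)) ?_
    -- At t = 0 the denominator is σ₀², so the formula extends continuously.
    rw [h.zero]
    simpa using hσ₀.ne'

theorem expIntegralEq_ddpm (h : IsAlphaBar A) (hσ₀ : 0 < σ₀) (hσ₁ : 0 < σ₁) :
    ExpIntegralEq (chi (ddpmAlpha A) (ddpmBeta A σ₀) σ₁)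
      (fun t => σ₁ ^ 2 * √(A t) / ((1 - A t) * σ₀ ^ 2 + A t * σ₁ ^ 2)) := by
  refine h.isSchedule_ddpm.expIntegralEq hσ₁ (fun t ht => ?_) ?_
  · rw [ddpmAlpha, ddpmBeta, mul_pow, Real.sq_sqrt (sub_nonneg.2 (h.le_one ht)),
      Real.sq_sqrt (h.pos ht).le]
  · have hA := h.continuousWithinAt_zero
    refine (continuousWithinAt_const.mul hA.sqrt).div (((continuousWithinAt_const.sub hA).mul
      continuousWithinAt_const).add (hA.mul continuousWithinAt_const)) ?_
    rw [h.zero]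
    simpa using hσ₀.ne'

theorem expIntegralEq_rectified (h : IsAlphaBar A) (hσ₀ : 0 < σ₀) (hσ₁ : 0 < σ₁) :
    ExpIntegralEq (chi (rectifiedAlpha A) (rectifiedBeta A σ₀) σ₁)
      (fun t => σ₁ ^ 2 * A t / ((1 - A t) ^ 2 * σ₀ ^ 2 + A t ^ 2 * σ₁ ^ 2)) := by
  refine h.isSchedule_rectified.expIntegralEq hσ₁ (fun t ht => ?_) ?_
  · rw [rectifiedAlpha, rectifiedBeta, mul_pow]
  · have hA := h.continuousWithinAt_zero
    refine (continuousWithinAt_const.mul hA).div ((((continuousWithinAt_const.sub hA).pow 2).mul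
      continuousWithinAt_const).add ((hA.pow 2).mul continuousWithinAt_const)) ?_
    rw [h.zero]
    simpa using hσ₀.ne'

end IsAlphaBar

end Examples
-- The main theorem.
theorem mainTheorem3 {d : ℕ} (p r : EuclideanSpace ℝ (Fin d) → ℝ) (σ₁ : ℝ) (hσ₁ : 0 < σ₁)
    (hp : IsPosC2Density p) (hlc : IsStronglyLogConcave (1 / σ₁ ^ 2) p)
    (hr : Differentiable ℝ r) :
    -- the norm bound, on `(0, 1]` and (when `a` extends continuously to `t = 0`) at `t = 0`,
    -- with equality for the centred Gaussian; `X` is an arbitrary trajectory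
    (∀ α β : ℝ → ℝ, IsSchedule α β →
      (∀ t ∈ Ioc (0 : ℝ) 1, IntervalIntegrable (chi α β σ₁) volume t 1) ∧
      ∀ X a : ℝ → EuclideanSpace ℝ (Fin d),
        IsLeanAdjoint α β (memorylessNoise α β) p r X a →
        (∀ t ∈ Ioc (0 : ℝ) 1,
          ‖a t‖ ≤ Real.exp (∫ s in t..1, chi α β σ₁ s) * ‖gradient r (X 1)‖) ∧
        (∀ L : ℝ, ContinuousWithinAt a (Icc 0 1) 0 →
          Tendsto (fun t => Real.exp (∫ s in t..1, chi α β σ₁ s)) (𝓝[>] 0) (𝓝 L) →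
          ‖a 0‖ ≤ L * ‖gradient r (X 1)‖) ∧
        (p = isoGaussianDensity 0 (σ₁ ^ 2) →
          (∀ t ∈ Ioc (0 : ℝ) 1,
            ‖a t‖ = Real.exp (∫ s in t..1, chi α β σ₁ s) * ‖gradient r (X 1)‖) ∧
          (∀ L : ℝ, ContinuousWithinAt a (Icc 0 1) 0 →
            Tendsto (fun t => Real.exp (∫ s in t..1, chi α β σ₁ s)) (𝓝[>] 0) (𝓝 L) →
            ‖a 0‖ = L * ‖gradient r (X 1)‖))) ∧
    -- the explicit factor for the three schedules
    (∀ (A : ℝ → ℝ) (σ₀ : ℝ), IsAlphaBar A → 0 < σ₀ →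
      (IsSchedule (follmerAlpha A) (follmerBeta A σ₀) ∧
        ExpIntegralEq (chi (follmerAlpha A) (follmerBeta A σ₀) σ₁)
          (fun t => σ₁ ^ 2 / ((1 - A t) * σ₀ ^ 2 + A t * σ₁ ^ 2))) ∧
      (IsSchedule (ddpmAlpha A) (ddpmBeta A σ₀) ∧
        ExpIntegralEq (chi (ddpmAlpha A) (ddpmBeta A σ₀) σ₁)
          (fun t => σ₁ ^ 2 * √(A t) / ((1 - A t) * σ₀ ^ 2 + A t * σ₁ ^ 2))) ∧
      (IsSchedule (rectifiedAlpha A) (rectifiedBeta A σ₀) ∧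
        ExpIntegralEq (chi (rectifiedAlpha A) (rectifiedBeta A σ₀) σ₁)
          (fun t => σ₁ ^ 2 * A t / ((1 - A t) ^ 2 * σ₀ ^ 2 + A t ^ 2 * σ₁ ^ 2)) ∧
        (σ₀ = σ₁ → ExpIntegralEq (chi (rectifiedAlpha A) (rectifiedBeta A σ₀) σ₁)
          (fun t => A t / ((1 - A t) ^ 2 + A t ^ 2))))) := by
  refine ⟨fun α β hs => ⟨fun t ht => hs.intervalIntegrable_chi hσ₁ ht, fun X a ha => ?_⟩,
    fun A σ₀ hA hσ₀ => ⟨⟨hA.isSchedule_follmer, hA.expIntegralEq_follmer hσ₀ hσ₁⟩,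
      ⟨hA.isSchedule_ddpm, hA.expIntegralEq_ddpm hσ₀ hσ₁⟩,
      hA.isSchedule_rectified, hA.expIntegralEq_rectified hσ₀ hσ₁, ?_⟩⟩
  · have hle : ∀ t ∈ Ioc (0 : ℝ) 1,
        ‖a t‖ ≤ Real.exp (∫ s in t..1, chi α β σ₁ s) * ‖gradient r (X 1)‖ := fun t ht =>
      ha.norm_le hs hσ₁
        (fun s hs' x v => inner_fderiv_baseDrift_le hσ₁ hp hlc (hs.eta_nonneg s hs') x v) ht
    refine ⟨hle, fun L ha0 hL => ?_, ?_⟩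
    · refine le_of_tendsto_of_tendsto (tendsto_norm_nhdsGT_zero ha0) (hL.mul_const _) ?_
      filter_upwards [eventually_mem_Ioc] with t ht using hle t ht
    · rintro rfl
      have heq : ∀ t ∈ Ioc (0 : ℝ) 1,
          ‖a t‖ = Real.exp (∫ s in t..1, chi α β σ₁ s) * ‖gradient r (X 1)‖ := fun t ht =>
        ha.norm_eq hs hσ₁ (fun s hs' x v => by
          rw [fderiv_baseDrift_isoGaussianDensity hσ₁ hp (hs.eta_nonneg s hs'), inner_smul_right,
            real_inner_self_eq_norm_sq]) ht
      refine ⟨heq, fun L ha0 hL => ?_⟩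
      refine tendsto_nhds_unique (tendsto_norm_nhdsGT_zero ha0) ((hL.mul_const _).congr' ?_)
      filter_upwards [eventually_mem_Ioc] with t ht using (heq t ht).symm
  · rintro rfl
    convert hA.expIntegralEq_rectified hσ₀ hσ₁ using 2 with t
    rw [← add_mul, mul_comm (σ₀ ^ 2), mul_div_mul_right _ _ (by positivity)]
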